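/- **Setting.** Fix a set $\mathcal X$ of variables. A word equation is a pair $(U_1,U_2)$ of words in the free monoid $\mathcal X^*$; write $U_i=U_{i,1}U_{i,2}\cdots U_{i,m_i}$ with $U_{i,j}\in\mathcal X$. Its set of boundaries is $B=B_1\cup B_2$, where $B_i=\{(i,j): 1\le j\le m_i\}$. An extended word equation $(U_1,U_2,<)$ is a word equation with a boundary order, i.e. a strict weak order $<$ on $B$ with $(i,j)<(i,j')$ whenever $j<j'$ and with $(1,m_1)\approx(2,m_2)$, where $\approx$ is incomparability (the last condition is void if a side is empty). The order is extended to $(1,0)\approx(2,0)$, both less than all boundaries. The equation is *nontrivial* if $U_1$ and $U_2$ are nonempty. It is *coherent* if there is a homomorphism $L:\mathcal X^*\to(\mathbb N,+)$, positive on $\mathcal X$, such that $(i,j)<(i',j')\iff L(U_{i,1}\cdots U_{i,j})<L(U_{i',1}\cdots U_{i',j'})$ for all boundaries. Its *dual* is obtained by exchanging the two sides. An *extended Nielsen transformation* of a nontrivial coherent $(U_1,U_2,<)$ is an extended word equation $(U_1',U_2',<')$, where $U_i'$ is $T(U_i)$ with its first letter removed, as follows. - (I) If $(1,1)\approx(2,1)$: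 the endomorphism $T$ of $\mathcal X^*$ sends $U_{2,1}\mapsto U_{1,1}$ and fixes the other variables, and $(i,j)<'(i',j')\iff(i,j+1)<(i',j'+1)$. - (II) If $(1,1)>(2,1)$: $T$ sends $U_{1,1}\mapsto U_{2,1}U_{1,1}$ and fixes the other variables. Put $\mu(i,j)=j+|\{j'\le j: U_{i,j'}=U_{1,1}\}|-1$, $\nu(i,j)=j-|\{j'\le j: U'_{i,j'}=U_{1,1}\}|+1$ and $B'^-=\{(i,\mu(i,j)):(i,j)\in B\setminus\{(2,1)\}\}$. Then $<'$ is any boundary order with $(i,j)<'(i',j')\iff(i,\nu(i,j))<(i',\nu(i',j'))$ for all $(i,j),(i',j')\in B'^-$. - (III) If $(1,1)<(2,1)$: the dual of a result of (II) applied to the dual of $(U_1,U_2,<)$. The transformation is *coherent* if its result is coherent. A coherent extended word equation is *terminating* if there is no infinite walk along coherent extended Nielsen transformations in the graph of the equations that can be reached from it by such transformations. The boundary $(i,j)$ *cuts* $(i',j')$ if $(i,j)\ne(i',j')$, $(i,j-1)<(i',j')$ and $(i',j'-1)<(i,j)$. It *mirrors* $(i',j')$ if $U_{i,j}=U_{i',j'}$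 and either $(i,j)\not\approx(i',j')$ or $(i,j-1)\not\approx(i',j'-1)$. The *cut graph* is the directed graph on $B$ with an edge from $b$ to $b'$ whenever $b$ cuts some $b''$ and $b''$ mirrors $b'$. It is *acyclic* if it has no closed walk of positive length (loops count as cycles), and *cyclic* otherwise. The equation is *staggered* if, for $0\le j\le m_1$ and $0\le j'\le m_2$, $(1,j)\approx(2,j')$ only when $(j,j')=(0,0)$ or $(j,j')=(m_1,m_2)$. The *hereditarily staggered* equations form the largest set $H$ of staggered coherent extended word equations such that (a) every nontrivial member of $H$ has a coherent extended Nielsen transformation whose result is staggered, and (b) every staggered equation obtained from a member of $H$ by a coherent extended Nielsen transformation is in $H$. **Theorem.** Let $(U_1,U_2,<)$ be a hereditarily staggered extended word equation. If $(U_1,U_2,<)$ is terminating, then its cut graph is acyclic. Moreover, if its cut graph is cyclic, then some coherent extended Nielsen transformation of $(U_1,U_2,<)$ yields a staggered extended word equation whose cut graph is again cyclic. -/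

import Mathlib

/-- A word equation `(U₁, U₂)` over a set `𝒳` of variables: a pair of words (elements of the free
monoid on `𝒳`, i.e. lists). The two sides are indexed by `Fin 2`, so `U 0` is `U₁` and `U 1` is
`U₂`. -/
abbrev WordEq (𝒳 : Type*) := Fin 2 → List 𝒳

namespace WordEq

variable {𝒳 : Type*}

/-- The set of boundaries: pairs `(i, j)` of a side `i` and a (one-based) index
`1 ≤ j ≤ |U i|`. -/
def boundaries (U : WordEq 𝒳) : Set (Fin 2 × ℕ) :=
  {p | 1 ≤ p.2 ∧ p.2 ≤ (U p.1).length}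

/-- The variable `U_{i,j}` at a boundary `(i, j)`. -/
def var (U : WordEq 𝒳) (a : U.boundaries) : 𝒳 :=
  (U a.1.1)[a.1.2 - 1]'(by
    have h := a.2
    simp only [boundaries, Set.mem_ofPred_eq] at h
    omega)

/-- A boundary order: an interleaving of the two totally ordered sets of boundaries, i.e. a strict
weak order on their union that extends the order of each side and in which the last boundaries
are equivalent. -/
structure IsBoundaryOrder (U : WordEq 𝒳) (lt : U.boundaries → U.boundaries → Prop) : Prop where
  strictWeak : IsStrictWeakOrder U.boundaries lt
  extends_side : ∀ a b : U.boundaries, a.1.1 = b.1.1 → a.1.2 < b.1.2 → lt a b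
  last_equiv : ∀ a b : U.boundaries,
    a.1.2 = (U a.1.1).length → b.1.2 = (U b.1.1).length → ¬ lt a b ∧ ¬ lt b a

/-- The endomorphism of the free monoid that sends the letter `x` to the word `u` and fixes every
other letter. -/
def subst [DecidableEq 𝒳] (x : 𝒳) (u : List 𝒳) (w : List 𝒳) : List 𝒳 :=
  w.flatMap fun y => if y = x then u else [y]

/-- `(i, j) ↦ (i, μ(i, j))` sends a boundary of `U` to the corresponding boundary of the
result of the substitution `x ↦ z x` followed by the removal of the first letter of each side. -/
def mu [DecidableEq 𝒳] (U : WordEq 𝒳) (x : 𝒳) (p : Fin 2 × ℕ) : ℕ :=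
  p.2 + ((U p.1).take p.2).count x - 1

/-- The left inverse of `mu`, computed in the new word equation `U'`. -/
def nu [DecidableEq 𝒳] (U' : WordEq 𝒳) (x : 𝒳) (p : Fin 2 × ℕ) : ℕ :=
  p.2 - ((U' p.1).take p.2).count x + 1

/-- The set of those boundaries of the new equation that come from a boundary of `U` other than
the first boundary of the second side. -/
def oldBoundaries [DecidableEq 𝒳] (U : WordEq 𝒳) (x : 𝒳) : Set (Fin 2 × ℕ) :=
  {q | ∃ p ∈ U.boundaries, p ≠ (1, 1) ∧ q = (p.1, U.mu x p)}

end WordEq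

/-- An extended word equation: a word equation with a boundary order. -/
structure ExtWordEq (𝒳 : Type*) where
  U : WordEq 𝒳
  lt : U.boundaries → U.boundaries → Prop
  isBoundaryOrder : U.IsBoundaryOrder lt

namespace ExtWordEq

variable {𝒳 : Type*}

/-- The boundary order, applied also to `(0, 0)` and `(1, 0)` (the left ends of the two sides),
which are equivalent to each other and less than every boundary. -/
def Lt (E : ExtWordEq 𝒳) (p q : Fin 2 × ℕ) : Prop :=
  (∃ (hp : p ∈ E.U.boundaries) (hq : q ∈ E.U.boundaries), E.lt ⟨p, hp⟩ ⟨q, hq⟩) ∨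
    (p.2 = 0 ∧ q ∈ E.U.boundaries)

/-- Incomparability for the boundary order; meaningful for boundaries, `(0, 0)` and `(1, 0)`. -/
def Equi (E : ExtWordEq 𝒳) (p q : Fin 2 × ℕ) : Prop :=
  ¬ E.Lt p q ∧ ¬ E.Lt q p

/-- Neither side is empty. -/
def IsNontrivial (E : ExtWordEq 𝒳) : Prop := ∀ i, E.U i ≠ []

/-- Coherence: the boundary order comes from an assignment of positive lengths to the variables
(a homomorphism from the free monoid to `ℕ` is given by its values `L` on the variables). -/
def Coherent (E : ExtWordEq 𝒳) : Prop :=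
  ∃ L : 𝒳 → ℕ, (∀ x, 0 < L x) ∧
    ∀ a b : E.U.boundaries,
      E.lt a b ↔
        (((E.U a.1.1).take a.1.2).map L).sum < (((E.U b.1.1).take b.1.2).map L).sum

/-- Exchange of the two sides in a pair `(i, j)`. -/
def swapSide (p : Fin 2 × ℕ) : Fin 2 × ℕ := (p.1.rev, p.2)

/-- The dual equation: the two sides are exchanged. -/
def dual (E : ExtWordEq 𝒳) : ExtWordEq 𝒳 where
  U := fun i => E.U i.rev
  lt := fun a b => E.lt ⟨swapSide a.1, a.2⟩ ⟨swapSide b.1, b.2⟩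
  isBoundaryOrder :=
    have := E.isBoundaryOrder.strictWeak
    { strictWeak :=
        { irrefl := fun _ => irrefl_of E.lt _
          trans := fun _ _ _ h₁ h₂ => trans_of E.lt h₁ h₂
          incomp_trans := fun _ _ _ h₁ h₂ =>
            IsStrictWeakOrder.incomp_trans (lt := E.lt) _ _ _ h₁ h₂ }
      extends_side := fun a b h₁ h₂ =>
        E.isBoundaryOrder.extends_side ⟨swapSide a.1, a.2⟩ ⟨swapSide b.1, b.2⟩
          (congrArg Fin.rev h₁) h₂
      last_equiv := fun a b h₁ h₂ =>
        E.isBoundaryOrder.last_equiv ⟨swapSide a.1, a.2⟩ ⟨swapSide b.1, b.2⟩ h₁ h₂ }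

section Nielsen

variable [DecidableEq 𝒳]

/-- Case I: the first boundaries are equivalent. -/
def NielsenI (E E' : ExtWordEq 𝒳) : Prop :=
  ∃ x z : 𝒳, (E.U 0).head? = some x ∧ (E.U 1).head? = some z ∧
    E.Equi (0, 1) (1, 1) ∧
    (∀ i, E'.U i = (WordEq.subst z [x] (E.U i)).tail) ∧
    ∀ a b : E'.U.boundaries,
      E'.lt a b ↔ E.Lt (a.1.1, a.1.2 + 1) (b.1.1, b.1.2 + 1)

/-- Case II: the first boundary of the first side is the larger one. The order of the boundaries
that come from old boundaries is prescribed; the new boundaries may be placed freely. -/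
def NielsenII (E E' : ExtWordEq 𝒳) : Prop :=
  ∃ x z : 𝒳, (E.U 0).head? = some x ∧ (E.U 1).head? = some z ∧
    E.Lt (1, 1) (0, 1) ∧
    (∀ i, E'.U i = (WordEq.subst x [z, x] (E.U i)).tail) ∧
    ∀ a b : E'.U.boundaries, a.1 ∈ E.U.oldBoundaries x → b.1 ∈ E.U.oldBoundaries x →
      (E'.lt a b ↔ E.Lt (a.1.1, E'.U.nu x a.1) (b.1.1, E'.U.nu x b.1))

/-- Case III: the first boundary of the first side is the smaller one; case II for the duals. -/
def NielsenIII (E E' : ExtWordEq 𝒳) : Prop :=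
  E.Lt (0, 1) (1, 1) ∧ ∃ F : ExtWordEq 𝒳, NielsenII E.dual F ∧ E' = F.dual

/-- `E'` is an extended Nielsen transformation of the nontrivial coherent equation `E`. -/
def Nielsen (E E' : ExtWordEq 𝒳) : Prop :=
  E.IsNontrivial ∧ E.Coherent ∧ (NielsenI E E' ∨ NielsenII E E' ∨ NielsenIII E E')

/-- `E'` is a coherent extended Nielsen transformation of `E`. -/
def CoherentNielsen (E E' : ExtWordEq 𝒳) : Prop :=
  Nielsen E E' ∧ E'.Coherent

/-- (Strong) termination: the graph of the coherent equations that can be reached from `E`, with an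
edge for each coherent extended Nielsen transformation, has no infinite walk. -/
def Terminating (E : ExtWordEq 𝒳) : Prop :=
  ¬ ∃ s : ℕ → ExtWordEq 𝒳,
      Relation.ReflTransGen CoherentNielsen E (s 0) ∧ ∀ n, CoherentNielsen (s n) (s (n + 1))

end Nielsen

/-- The boundary `a = (i, j)` cuts `b = (i', j')`: they are distinct, `(i, j - 1) < (i', j')` and
`(i', j' - 1) < (i, j)`. -/
def Cuts (E : ExtWordEq 𝒳) (a b : E.U.boundaries) : Prop :=
  a ≠ b ∧ E.Lt (a.1.1, a.1.2 - 1) b.1 ∧ E.Lt (b.1.1, b.1.2 - 1) a.1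

/-- The boundary `a` mirrors `b`: they carry the same variable, at different positions. -/
def Mirrors (E : ExtWordEq 𝒳) (a b : E.U.boundaries) : Prop :=
  E.U.var a = E.U.var b ∧
    (¬ E.Equi a.1 b.1 ∨ ¬ E.Equi (a.1.1, a.1.2 - 1) (b.1.1, b.1.2 - 1))

/-- The cut graph. -/
def cutGraph (E : ExtWordEq 𝒳) : Digraph E.U.boundaries where
  Adj a b := ∃ c, E.Cuts a c ∧ E.Mirrors c b

/-- Staggered: boundaries of different sides are equivalent only at the two ends. -/
def Staggered (E : ExtWordEq 𝒳) : Prop :=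
  ∀ j ≤ (E.U 0).length, ∀ j' ≤ (E.U 1).length, E.Equi (0, j) (1, j') →
    (j = 0 ∧ j' = 0) ∨ (j = (E.U 0).length ∧ j' = (E.U 1).length)

section Hereditary

variable [DecidableEq 𝒳]

/-- The closure conditions in the definition of hereditarily staggered equations, for a set `S` of
staggered coherent equations. -/
structure IsHereditarySet (S : Set (ExtWordEq 𝒳)) : Prop where
  staggered : ∀ E ∈ S, E.Staggered
  coherent : ∀ E ∈ S, E.Coherent
  exists_step : ∀ E ∈ S, E.IsNontrivial → ∃ E', CoherentNielsen E E' ∧ E'.Staggered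
  closed : ∀ E ∈ S, ∀ E', CoherentNielsen E E' → E'.Staggered → E' ∈ S

/-- Membership in the largest set with these closure conditions. -/
def HereditarilyStaggered (E : ExtWordEq 𝒳) : Prop :=
  ∃ S : Set (ExtWordEq 𝒳), IsHereditarySet S ∧ E ∈ S

/-- The largest set exists, and `HereditarilyStaggered` describes it. -/
theorem isGreatest_hereditarilyStaggered :
    IsGreatest {S : Set (ExtWordEq 𝒳) | IsHereditarySet S} {E | HereditarilyStaggered E} := by
  refine ⟨⟨?_, ?_, ?_, ?_⟩, fun S hS E hE => ⟨S, hS, hE⟩⟩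
  · rintro E ⟨S, hS, hE⟩
    exact hS.staggered E hE
  · rintro E ⟨S, hS, hE⟩
    exact hS.coherent E hE
  · rintro E ⟨S, hS, hE⟩
    exact hS.exists_step E hE
  · rintro E ⟨S, hS, hE⟩ E' h h'
    exact ⟨S, hS, hS.closed E hE E' h h'⟩

end Hereditary

end ExtWordEq

/-- A directed graph (loops allowed) is acyclic if it has no closed walk of nonzero length. -/
def Digraph.IsAcyclicDigraph {V : Type*} (G : Digraph V) : Prop :=
  ∀ v, ¬ Relation.TransGen G.Adj v v

/-! For lengths `L` that realize the boundary order, cutting means overlapping an occurrence on the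
other side, and mirroring means being a twin of an occurrence with the same letter. Suppose the
sides begin with `x` and a shorter `z`. The transformation replaces `x` by `z x` and deletes the
leading `z` of both sides. Every later occurrence of `x` splits into a `z`-part and an `x`-part,
separated by a new boundary whose place is not prescribed. The new boundaries have to be placed so
that a cycle survives.

Assume that every admissible placement is acyclic. Acyclicity makes placements flexible: in an
acyclic staggered equation two adjacent boundaries of different sides can be exchanged by changing
the lengths (`exists_swap`). The overlap between them is made negative, and the two occurrences that
lose it are compensated by thickening other overlaps. This lengthens their neighbours, hence all
twins of these neighbours, which must be compensated in turn; acyclicity makes the process stop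
(`exists_flow`). Repeated exchanges move a single new boundary into any occurrence that meets the
block `z x` around it (`exists_move`).

This freedom produces a cycle after all. Cut the given cycle at its mirror edges between occurrences
of `x` (`exists_pattern`); the remaining segments lift to the new equation (`walk_lift`). If no such
edge occurs, the cycle itself lifts. If a segment joins different occurrences `d` and `c` of `x`,
move the boundary inside `c` so that both parts of `c` can end the lifted walk; its start has letter
`x` or `z`, so it mirrors one of these parts. If there are only closed segments, two of them, at
different occurrences `d` and `c`, are joined by two mirror edges, after the boundary inside `c` has
been moved so that the ends at `c` can carry the letters found at `d`.

If the first boundaries are equivalent, staggeredness leaves one letter on each side and the cut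
graph has no edges. The remaining case is dual. Hereditary staggeredness supplies one staggered
coherent transformation to start from and allows iteration, so a cyclic cut graph leads to an
infinite walk. -/

/-! ### Positions, overlaps and twins relative to a length function -/

namespace WordEq

variable {𝒳 : Type*}

/-- The length of the prefix of a side that ends at the boundary `p`. -/
def pos (U : WordEq 𝒳) (L : 𝒳 → ℕ) (p : Fin 2 × ℕ) : ℕ :=
  (((U p.1).take p.2).map L).sum

/-- The letter that ends at the boundary `p`. -/
def letter (U : WordEq 𝒳) (p : Fin 2 × ℕ) : Option 𝒳 := (U p.1)[p.2 - 1]?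

/-- The boundary (or left end) preceding `p` on the same side. -/
def pred (p : Fin 2 × ℕ) : Fin 2 × ℕ := (p.1, p.2 - 1)

/-- The letter occurrences ending at `p` and `q` lie on different sides and overlap. -/
def Overlap (U : WordEq 𝒳) (L : 𝒳 → ℕ) (p q : Fin 2 × ℕ) : Prop :=
  p ∈ U.boundaries ∧ q ∈ U.boundaries ∧ p.1 ≠ q.1 ∧
    U.pos L (pred p) < U.pos L q ∧ U.pos L (pred q) < U.pos L p

/-- Two distinct occurrences of the same letter. -/
def Twin (U : WordEq 𝒳) (p q : Fin 2 × ℕ) : Prop :=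
  p ∈ U.boundaries ∧ q ∈ U.boundaries ∧ p ≠ q ∧ U.letter p = U.letter q

/-- Composition of an overlap and a twin step. -/
def Step (U : WordEq 𝒳) (L : 𝒳 → ℕ) (p q : Fin 2 × ℕ) : Prop :=
  ∃ c, U.Overlap L p c ∧ U.Twin c q

/-- There is a closed walk of overlap-twin steps. -/
def Cyclic (U : WordEq 𝒳) (L : 𝒳 → ℕ) : Prop :=
  ∃ p, Relation.TransGen (U.Step L) p p

/-- The length function `L` is positive and gives the same length to both sides. -/
structure Balanced (U : WordEq 𝒳) (L : 𝒳 → ℕ) : Prop where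
  pos_letter : ∀ y, 0 < L y
  total : ∀ i i', U.pos L (i, (U i).length) = U.pos L (i', (U i').length)

/-- Boundaries of different sides have the same position only at the two ends. -/
def StaggeredBy (U : WordEq 𝒳) (L : 𝒳 → ℕ) : Prop :=
  ∀ i i' : Fin 2, i ≠ i' → ∀ j ≤ (U i).length, ∀ j' ≤ (U i').length,
    U.pos L (i, j) = U.pos L (i', j') →
      (j = 0 ∧ j' = 0) ∨ (j = (U i).length ∧ j' = (U i').length)

@[simp] theorem pos_zero (U : WordEq 𝒳) (L : 𝒳 → ℕ) (i : Fin 2) : U.pos L (i, 0) = 0 := by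
  simp [pos]

theorem letter_eq_some {U : WordEq 𝒳} {p : Fin 2 × ℕ} (hp : p ∈ U.boundaries) :
    ∃ y, U.letter p = some y := by
  obtain ⟨h1, h2⟩ := hp
  exact ⟨(U p.1)[p.2 - 1]'(by omega), List.getElem?_eq_getElem (by omega)⟩

theorem pos_succ {U : WordEq 𝒳} (L : 𝒳 → ℕ) {i : Fin 2} {j : ℕ} {y : 𝒳}
    (h : U.letter (i, j + 1) = some y) : U.pos L (i, j + 1) = U.pos L (i, j) + L y := by
  have h' : (U i)[j]? = some y := h
  obtain ⟨hj, rfl⟩ := List.getElem?_eq_some_iff.1 h'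
  show (((U i).take (j + 1)).map L).sum = (((U i).take j).map L).sum + _
  rw [List.take_succ_eq_append_getElem hj, List.map_append, List.sum_append]
  simp

theorem pos_lt_succ {U : WordEq 𝒳} {L : 𝒳 → ℕ} (hL : ∀ y, 0 < L y) {i : Fin 2} {j : ℕ}
    (h : j < (U i).length) : U.pos L (i, j) < U.pos L (i, j + 1) := by
  obtain ⟨y, hy⟩ := letter_eq_some (U := U) (p := (i, j + 1)) ⟨by simp, h⟩
  have := hL y
  rw [pos_succ L hy]; omega

theorem pos_lt_pos {U : WordEq 𝒳} {L : 𝒳 → ℕ} (hL : ∀ y, 0 < L y) {i : Fin 2} {j k : ℕ}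
    (hjk : j < k) (h : k ≤ (U i).length) : U.pos L (i, j) < U.pos L (i, k) := by
  induction k, hjk using Nat.le_induction with
  | base => exact pos_lt_succ hL h
  | succ k hk ih => exact (ih (by omega)).trans (pos_lt_succ hL h)

theorem pos_lt_pos_iff {U : WordEq 𝒳} {L : 𝒳 → ℕ} (hL : ∀ y, 0 < L y) {i : Fin 2} {j k : ℕ}
    (hj : j ≤ (U i).length) (hk : k ≤ (U i).length) :
    U.pos L (i, j) < U.pos L (i, k) ↔ j < k := by
  refine ⟨fun h => ?_, fun h => pos_lt_pos hL h hk⟩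
  by_contra hc
  rcases (not_lt.1 hc).eq_or_lt with rfl | h'
  · exact lt_irrefl _ h
  · exact lt_asymm h (pos_lt_pos hL h' hj)

theorem pos_le_pos {U : WordEq 𝒳} {L : 𝒳 → ℕ} (hL : ∀ y, 0 < L y) {i : Fin 2} {j k : ℕ}
    (hjk : j ≤ k) (h : k ≤ (U i).length) : U.pos L (i, j) ≤ U.pos L (i, k) := by
  rcases hjk.eq_or_lt with rfl | h'
  · rfl
  · exact (pos_lt_pos hL h' h).le

theorem pos_le_pos_of_side_eq {U : WordEq 𝒳} {L : 𝒳 → ℕ} (hL : ∀ y, 0 < L y) {p q : Fin 2 × ℕ}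
    (hpq : p.1 = q.1) (hle : p.2 ≤ q.2) (hq : q.2 ≤ (U q.1).length) : U.pos L p ≤ U.pos L q := by
  obtain ⟨i, j⟩ := p
  obtain ⟨i', k⟩ := q
  obtain rfl : i = i' := hpq
  exact pos_le_pos hL hle hq

theorem Overlap.symm {U : WordEq 𝒳} {L : 𝒳 → ℕ} {p q : Fin 2 × ℕ} (h : U.Overlap L p q) :
    U.Overlap L q p :=
  ⟨h.2.1, h.1, h.2.2.1.symm, h.2.2.2.2, h.2.2.2.1⟩

theorem Twin.symm {U : WordEq 𝒳} {p q : Fin 2 × ℕ} (h : U.Twin p q) : U.Twin q p :=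
  ⟨h.2.1, h.1, h.2.2.1.symm, h.2.2.2.symm⟩

theorem two_le {U : WordEq 𝒳} {p : Fin 2 × ℕ} (hp : p ∈ U.boundaries)
    (h0 : p ≠ (0, 1)) (h1 : p ≠ (1, 1)) : 2 ≤ p.2 := by
  obtain ⟨i, j⟩ := p
  obtain ⟨hj, -⟩ := hp
  by_contra hc
  have : j = 1 := by simp only at hj hc; omega
  subst this
  fin_cases i <;> simp at h0 h1

theorem pred_mem {U : WordEq 𝒳} {p : Fin 2 × ℕ} (hp : p ∈ U.boundaries) (h2 : 2 ≤ p.2) :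
    pred p ∈ U.boundaries :=
  ⟨by simp only [pred]; omega, by have := hp.2; simp only [pred]; omega⟩

theorem pos_pred_lt {V : WordEq 𝒳} {L' : 𝒳 → ℕ} (hl : ∀ y, 0 < L' y) {p : Fin 2 × ℕ}
    (hp : p ∈ V.boundaries) : V.pos L' (pred p) < V.pos L' p :=
  pos_lt_pos hl (by have := hp.1; omega) hp.2

theorem pos_pos_of_mem {V : WordEq 𝒳} {L' : 𝒳 → ℕ} (hl : ∀ y, 0 < L' y) {p : Fin 2 × ℕ}
    (hp : p ∈ V.boundaries) : 0 < V.pos L' p :=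
  Nat.zero_lt_of_lt (pos_pred_lt hl hp)

theorem side_eq_or {i i' : Fin 2} (h : i ≠ i') (s : Fin 2) : s = i ∨ s = i' := by
  revert i i' s; decide

/-- Every letter occurrence overlaps one of the other side. -/
theorem exists_overlap {U : WordEq 𝒳} {L : 𝒳 → ℕ} (hL : U.Balanced L) {i i' : Fin 2}
    (hi : i ≠ i') {j : ℕ} (hj : (i, j) ∈ U.boundaries) : ∃ k, U.Overlap L (i, j) (i', k) := by
  classical
  have hlen := hL.total i i'
  obtain ⟨h1, h2⟩ := hj
  replace h2 : j ≤ (U i).length := h2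
  -- The partner is the first boundary of the other side at or beyond `(i, j)`; one exists because
  -- the sides have equal total length.
  have hex : ∃ k, k ≤ (U i').length ∧ U.pos L (i, j) ≤ U.pos L (i', k) :=
    ⟨_, le_rfl, hlen ▸ pos_le_pos hL.pos_letter h2 le_rfl⟩
  have hpos : 0 < U.pos L (i, j) := by
    simpa using pos_lt_pos (U := U) hL.pos_letter (i := i) (j := 0) (k := j) h1 h2
  refine ⟨Nat.find hex, ⟨h1, h2⟩, ⟨?_, (Nat.find_spec hex).1⟩, hi, ?_, ?_⟩
  · rw [Nat.one_le_iff_ne_zero]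
    intro h0
    replace h0 : Nat.find hex = 0 := h0
    have := (Nat.find_spec hex).2
    simp only [h0, pos_zero] at this
    omega
  · exact lt_of_lt_of_le (pos_lt_pos hL.pos_letter (by simp only; omega) h2)
      (Nat.find_spec hex).2
  · have h0 : Nat.find hex ≠ 0 := by
      intro h0
      have := (Nat.find_spec hex).2
      simp only [h0, pos_zero] at this
      omega
    have := Nat.find_min hex (m := Nat.find hex - 1) (by omega)
    have h3 := (Nat.find_spec hex).1
    simp only [pred]
    by_contra hc
    exact this ⟨by omega, not_lt.1 hc⟩

/-! ### Flows along acyclic relations, and the exchange of two adjacent boundaries -/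

/-- Weights that satisfy a flow recursion along an acyclic relation on a finite set. -/
theorem exists_flow {V : Type*} (s : Finset V) (R : V → V → Prop) [∀ b v, Decidable (R b v)]
    (hR : ∀ v, ¬ Relation.TransGen R v v) (src : V → ℕ) :
    ∃ N : V → ℕ, ∀ v ∈ s, N v = src v + ∑ b ∈ s with R b v, N b := by
  classical
  let R' : s → s → Prop := Relation.TransGen fun a b => R a b
  have hirr : Std.Irrefl R' := ⟨fun v hv => hR v (Relation.TransGen.lift
    (r := fun a b : s => R a b) Subtype.val (fun _ _ h => h) _ _ hv)⟩
  have htr : IsTrans s R' := ⟨fun _ _ _ => Relation.TransGen.trans⟩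
  have hwf : WellFounded R' := Finite.wellFounded_of_trans_of_irrefl R'
  let F : (v : s) → ((b : s) → R' b v → ℕ) → ℕ := fun v f =>
    src v + ∑ b : s, if h : R b v then f b (.single h) else 0
  let N' : s → ℕ := hwf.fix F
  have hN' : ∀ v : s, N' v = src v + ∑ b : s, if R b v then N' b else 0 := by
    intro v
    show hwf.fix F v = _
    rw [hwf.fix_eq]
    simp only [F, N', dite_eq_ite]
  refine ⟨fun v => if h : v ∈ s then N' ⟨v, h⟩ else 0, fun v hv => ?_⟩
  simp only [hv, dite_true]
  rw [hN', Finset.sum_filter, ← Finset.sum_coe_sort s]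
  congr 1
  refine Finset.sum_congr rfl fun b _ => ?_
  simp

end WordEq

namespace WordEq

variable {𝒳 : Type*}

theorem finite_boundaries (U : WordEq 𝒳) : U.boundaries.Finite := by
  refine ((Set.finite_univ (α := Fin 2)).prod
    (Set.finite_Iic ((U 0).length + (U 1).length))).subset ?_
  rintro ⟨i, j⟩ ⟨-, h2⟩
  refine ⟨trivial, ?_⟩
  fin_cases i <;> simp_all <;> omega

open Classical in
/-- Given a neighbour `c b` of every boundary `b` in an acyclic equation, there are lengths `D`
such that each position in `D` counts, with multiplicities `N`, the overlaps `(b, c b)` to its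
left, minus one if one prescribed overlap is to its left. -/
theorem exists_lengths_of_neighbours {U : WordEq 𝒳} {L : 𝒳 → ℕ} (hac : ¬ U.Cyclic L)
    {c : Fin 2 × ℕ → Fin 2 × ℕ} (hc : ∀ b ∈ U.boundaries, U.Overlap L b (c b)) (e : Fin 2 → ℕ)
    (he : ∀ s, 1 ≤ e s) :
    ∃ (D : 𝒳 → ℕ) (N : Fin 2 × ℕ → ℕ), ∀ s : Fin 2, ∀ n ≤ (U s).length,
      U.pos D (s, n) + (if e s ≤ n then 1 else 0) =
        ∑ b ∈ U.finite_boundaries.toFinset,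
          if (if b.1 = s then b.2 else (c b).2) ≤ n then N b else 0 := by
  set V := U.finite_boundaries.toFinset with hV
  have hmem : ∀ b, b ∈ V ↔ b ∈ U.boundaries := fun b => by simp [hV]
  -- `N b` is the amount by which the overlap `(b, c b)` is thickened. This lengthens `c b`, so each
  -- twin `v` of `c b` must gain the same amount through its own overlap. The source compensates the
  -- prescribed overlap, which loses one.
  obtain ⟨N, hN⟩ := exists_flow V (fun b v => b ∈ U.boundaries ∧ U.Twin (c b) v)
    (fun v hv => hac ⟨v, Relation.TransGen.mono (fun b v h => ⟨c b, hc b h.1, h.2⟩) _ _ hv⟩)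
    (fun v => if e v.1 = v.2 then 1 else 0)
  -- The length of `y` collects what all occurrences of `y` receive as chosen neighbours, so it
  -- depends on the letter only.
  refine ⟨fun y => ∑ b ∈ V with U.letter (c b) = some y, N b, N, fun s n => ?_⟩
  induction n with
  | zero =>
    intro _
    rw [pos_zero, if_neg (by have := he s; omega), eq_comm]
    refine Finset.sum_eq_zero fun b hb => if_neg ?_
    have h1 := ((hmem b).1 hb).1
    have h2 := (hc b ((hmem b).1 hb)).2.1.1
    split_ifs <;> omega
  | succ n ih =>
    intro hn
    specialize ih (by omega)
    have hv : (s, n + 1) ∈ U.boundaries := ⟨by simp, hn⟩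
    obtain ⟨y, hy⟩ := letter_eq_some hv
    have hNv := hN (s, n + 1) ((hmem _).2 hv)
    rw [pos_succ _ hy]
    have hsum1 : ∑ b ∈ V with U.letter (c b) = some y, N b =
        (∑ b ∈ V with (b ∈ U.boundaries ∧ U.Twin (c b) (s, n + 1)), N b) +
          ∑ b ∈ V with c b = (s, n + 1), N b := by
      simp only [Finset.sum_filter, ← Finset.sum_add_distrib]
      refine Finset.sum_congr rfl fun b hb => ?_
      have hb' := (hmem b).1 hb
      have hcb := (hc b hb').2.1
      by_cases h1 : c b = (s, n + 1)
      · simp [h1, hy, Twin]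
      · simp [h1, Twin, hb', hcb, hv, hy]
    -- The newly counted pairs have `(s, n + 1)` either as `b` or as `c b`, never both, since the
    -- members of a pair lie on different sides.
    have hsum2 : (∑ b ∈ V, if (if b.1 = s then b.2 else (c b).2) ≤ n + 1 then N b else 0) =
        (∑ b ∈ V, if (if b.1 = s then b.2 else (c b).2) ≤ n then N b else 0) +
          (N (s, n + 1) + ∑ b ∈ V with c b = (s, n + 1), N b) := by
      have hNs : N (s, n + 1) = ∑ b ∈ V, if b = (s, n + 1) then N b else 0 := by
        rw [Finset.sum_ite_eq' V (s, n + 1) N, if_pos ((hmem _).2 hv)]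
      rw [hNs, Finset.sum_filter, ← Finset.sum_add_distrib, ← Finset.sum_add_distrib]
      refine Finset.sum_congr rfl fun b hb => ?_
      have hne := (hc b ((hmem b).1 hb)).2.2.1
      by_cases hbs : b.1 = s
      · have h2 : c b ≠ (s, n + 1) := fun h => hne (by rw [hbs, h])
        have h3 : b = (s, n + 1) ↔ b.2 = n + 1 := by simp [Prod.ext_iff, hbs]
        simp only [if_pos hbs, if_neg h2, h3]
        split_ifs <;> omega
      · have h2 : b ≠ (s, n + 1) := fun h => hbs (by rw [h])
        have h4 : (c b).1 = s := by
          rcases side_eq_or hne s with h | h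
          · exact absurd h.symm hbs
          · exact h.symm
        have h3 : c b = (s, n + 1) ↔ (c b).2 = n + 1 := by simp [Prod.ext_iff, h4]
        simp only [if_neg hbs, if_neg h2, h3]
        split_ifs <;> omega
    rw [hsum2, ← ih, hsum1, hNv]
    simp only
    split_ifs <;> omega

/-- In an acyclic staggered equation, two adjacent interior boundaries `(i, j)` and `(i', k)` of
different sides can be exchanged by changing the lengths. -/
theorem exists_swap {U : WordEq 𝒳} {L : 𝒳 → ℕ} (hL : U.Balanced L) (hs : U.StaggeredBy L)
    (hac : ¬ U.Cyclic L) {i i' : Fin 2} (hi : i ≠ i') {j k : ℕ} (hj : 1 ≤ j)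
    (hj' : j < (U i).length) (hk : 1 ≤ k) (hk' : k < (U i').length)
    (h1 : U.pos L (i, j) < U.pos L (i', k)) (h2 : U.pos L (i', k) < U.pos L (i, j + 1))
    (h3 : U.pos L (i', k - 1) < U.pos L (i, j)) :
    ∃ L' : 𝒳 → ℕ, U.Balanced L' ∧ U.StaggeredBy L' ∧ U.pos L' (i', k) < U.pos L' (i, j) ∧
      ∀ s t : Fin 2 × ℕ, s.2 ≤ (U s.1).length → t.2 ≤ (U t.1).length →
        ¬ (s = (i, j) ∧ t = (i', k)) → ¬ (t = (i, j) ∧ s = (i', k)) →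
          (U.pos L' s < U.pos L' t ↔ U.pos L s < U.pos L t) := by
  classical
  have hp := hL.pos_letter
  -- The occurrences `(i, j + 1)` and `(i', k)` overlap exactly between the two boundaries to be
  -- exchanged. This overlap is to disappear, so it must not be used for compensation; each of the
  -- two has another neighbour.
  have hex : ∀ b, ∃ c, b ∈ U.boundaries → U.Overlap L b c ∧
      ¬ (b = (i, j + 1) ∧ c = (i', k)) ∧ ¬ (b = (i', k) ∧ c = (i, j + 1)) := by
    intro b
    by_cases hb : b ∈ U.boundaries
    swap
    · exact ⟨b, fun h => absurd h hb⟩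
    by_cases hb1 : b = (i, j + 1)
    · subst hb1
      refine ⟨(i', k + 1), fun _ => ⟨⟨hb, ⟨by simp, hk'⟩, hi, ?_, ?_⟩, ?_, ?_⟩⟩
      · exact h1.trans (pos_lt_succ hp hk')
      · exact h2
      · simp
      · simp [hi]
    by_cases hb2 : b = (i', k)
    · subst hb2
      refine ⟨(i, j), fun _ => ⟨⟨hb, ⟨hj, hj'.le⟩, hi.symm, h3, ?_⟩, ?_, ?_⟩⟩
      · exact lt_of_le_of_lt (pos_le_pos hp (Nat.sub_le _ _) hj'.le) h1
      · simp [hi.symm]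
      · simp
    obtain ⟨i0, n⟩ := b
    have : ∃ i1, i0 ≠ i1 := ⟨i0.rev, by clear * -; revert i0; decide⟩
    obtain ⟨i1, hi1⟩ := this
    obtain ⟨m, hm⟩ := exists_overlap hL hi1 hb
    exact ⟨_, fun _ => ⟨hm, fun h => hb1 h.1, fun h => hb2 h.1⟩⟩
  choose c hc using hex
  set e : Fin 2 → ℕ := fun s => if s = i then j + 1 else k with he
  have hei : e i = j + 1 := by simp [he]
  have hei' : e i' = k := by simp [he, hi.symm]
  obtain ⟨D, N, hD⟩ := exists_lengths_of_neighbours hac (fun b hb => (hc b hb).1) e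
    (fun s => by rcases side_eq_or hi s with rfl | rfl <;> omega)
  set V := U.finite_boundaries.toFinset with hV
  have hmem : ∀ b, b ∈ V ↔ b ∈ U.boundaries := fun b => by simp [hV]
  -- passing from a position to a larger one on the other side does not decrease the count
  have hmono : ∀ s s' : Fin 2, s ≠ s' → ∀ n n' : ℕ, n ≤ (U s).length → n' ≤ (U s').length →
      U.pos L (s, n) < U.pos L (s', n') →
      U.pos D (s, n) + (if e s ≤ n then 1 else 0) ≤
        U.pos D (s', n') + (if e s' ≤ n' then 1 else 0) := by
    intro s s' hss n n' hn hn' hlt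
    rw [hD s n hn, hD s' n' hn']
    refine Finset.sum_le_sum fun b hb => ?_
    obtain ⟨hb1, hb2, hb3, hb4, hb5⟩ := (hc b ((hmem b).1 hb)).1
    have key : (if b.1 = s then b.2 else (c b).2) ≤ n →
        (if b.1 = s' then b.2 else (c b).2) ≤ n' := by
      intro h
      by_cases hbs : b.1 = s
      · have hcs : (c b).1 = s' := ((side_eq_or hss (c b).1).resolve_left (hbs ▸ hb3.symm))
        rw [if_pos hbs] at h
        rw [if_neg (hbs ▸ hss)]
        have h6 : U.pos L b ≤ U.pos L (s, n) := by
          have := pos_le_pos (U := U) (i := s) hp h hn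
          rwa [← hbs, Prod.mk.eta, hbs] at this
        have h7 := hb5.trans_le h6 |>.trans hlt
        have h8 := hb2.2
        rw [pred, hcs, pos_lt_pos_iff hp (by rw [hcs] at h8; omega) hn'] at h7
        omega
      · have hbs' : b.1 = s' := ((side_eq_or hss b.1).resolve_left hbs)
        have hcs : (c b).1 = s :=
          ((side_eq_or hss (c b).1).resolve_right (hbs' ▸ hb3.symm))
        rw [if_neg hbs] at h
        rw [if_pos hbs']
        have h6 : U.pos L (c b) ≤ U.pos L (s, n) := by
          have := pos_le_pos (U := U) (i := s) hp h hn
          rwa [← hcs, Prod.mk.eta, hcs] at this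
        have h7 := hb4.trans_le h6 |>.trans hlt
        have h8 := hb1.2
        rw [pred, hbs', pos_lt_pos_iff hp (by rw [hbs'] at h8; omega) hn'] at h7
        omega
    by_cases h4 : (if b.1 = s then b.2 else (c b).2) ≤ n
    · rw [if_pos h4, if_pos (key h4)]
    · rw [if_neg h4]
      exact Nat.zero_le _
  -- No chosen overlap separates the two boundaries, so their counts agree. Only the correction for
  -- the excluded overlap differs.
  have hpq : U.pos D (i', k) + 1 = U.pos D (i, j) := by
    have e1 := hD i j hj'.le
    have e2 := hD i' k hk'.le
    rw [if_neg (by omega)] at e1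
    rw [if_pos (by omega)] at e2
    rw [e2, ← add_zero (U.pos D (i, j)), e1]
    refine Finset.sum_congr rfl fun b hb => ?_
    obtain ⟨⟨hb1, hb2, hb3, hb4, hb5⟩, hb6, hb7⟩ := hc b ((hmem b).1 hb)
    have aux : ∀ m m' : ℕ, m ≤ (U i).length → 1 ≤ m → m' ≤ (U i').length → 1 ≤ m' →
        U.pos L (i, m - 1) < U.pos L (i', m') → U.pos L (i', m' - 1) < U.pos L (i, m) →
        ¬ (m = j + 1 ∧ m' = k) → (m' ≤ k ↔ m ≤ j) := by
      intro m m' hm hm1 hm' hm1' g1 g2 g3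
      constructor
      · intro g4
        by_contra g5
        have g6 : U.pos L (i', m') ≤ U.pos L (i', k) := pos_le_pos hp g4 hk'.le
        have g7 : m - 1 < j + 1 :=
          (pos_lt_pos_iff hp (by omega) (by omega)).1 (g1.trans_le g6 |>.trans h2)
        have g8 : m = j + 1 := by omega
        have g9 : m' < k := lt_of_le_of_ne g4 fun h => g3 ⟨g8, h⟩
        have g10 : U.pos L (i', m') ≤ U.pos L (i', k - 1) :=
          pos_le_pos hp (by omega) (by omega)
        rw [g8, Nat.add_sub_cancel] at g1
        omega
      · intro g4
        have g6 : U.pos L (i, m) ≤ U.pos L (i, j) := pos_le_pos hp g4 hj'.le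
        have g7 : m' - 1 < k :=
          (pos_lt_pos_iff hp (by omega) (by omega)).1 (g2.trans_le g6 |>.trans h1)
        omega
    obtain ⟨s, n⟩ := b
    obtain ⟨⟨s', n'⟩, hcb⟩ : ∃ q, c (s, n) = q := ⟨_, rfl⟩
    rw [hcb] at hb2 hb3 hb4 hb5 hb6 hb7
    simp only [hcb]
    rcases side_eq_or hi s with rfl | rfl
    · have hs' : s' = i' := (side_eq_or hi s').resolve_left fun h => hb3 h.symm
      subst hs'
      have := aux n n' hb1.2 hb1.1 hb2.2 hb2.1 hb4 hb5 (by simpa using hb6)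
      simp only [if_neg hi, if_true, this]
    · have hs' : s' = i := (side_eq_or hi s').resolve_right fun h => hb3 h.symm
      subst hs'
      have := aux n' n hb2.2 hb2.1 hb1.2 hb1.1 hb5 hb4
        (by simpa [and_comm] using hb7)
      simp only [if_neg hi.symm, if_true, this]
  have htot : ∀ s s' : Fin 2, U.pos D (s, (U s).length) = U.pos D (s', (U s').length) := by
    have key : ∀ s : Fin 2, U.pos D (s, (U s).length) + 1 = ∑ b ∈ V, N b := by
      intro s
      have := hD s _ le_rfl
      rw [if_pos (by rcases side_eq_or hi s with rfl | rfl <;> omega)] at this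
      rw [this]
      refine Finset.sum_congr rfl fun b hb => if_pos ?_
      obtain ⟨hb1, hb2, hb3, -⟩ := (hc b ((hmem b).1 hb)).1
      split_ifs with h
      · exact h ▸ hb1.2
      · exact ((side_eq_or hb3 s).resolve_left fun h' => h h'.symm) ▸ hb2.2
    intro s s'
    have := key s
    have := key s'
    omega
  set T := U.pos L (i', k) - U.pos L (i, j) with hT
  -- With these coefficients the gap between the two boundaries changes from `T` to `2 * T - (2 * T
  -- + 1) = -1`, whereas an old gap of at least `T + 1` stays positive even if `D` drops by one.
  set L' : 𝒳 → ℕ := fun y => 2 * L y + (2 * T + 1) * D y with hL'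
  have hposL' : ∀ p, U.pos L' p = 2 * U.pos L p + (2 * T + 1) * U.pos D p := by
    intro p
    simp only [pos, hL']
    rw [List.sum_map_add, List.sum_map_mul_left, List.sum_map_mul_left]
  have hp' : ∀ y, 0 < L' y := fun y => by have := hp y; simp only [hL']; positivity
  have hbal : U.Balanced L' := ⟨hp', fun s s' => by
    rw [hposL', hposL', hL.total s s', htot s s']⟩
  have hflip : U.pos L' (i', k) < U.pos L' (i, j) := by
    rw [hposL', hposL', ← hpq]
    have : U.pos L (i', k) = U.pos L (i, j) + T := by omega
    rw [this]; ring_nf; omega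
  have hkeep : ∀ s s' : Fin 2, s ≠ s' → ∀ n n' : ℕ, n ≤ (U s).length → n' ≤ (U s').length →
      ¬ ((s, n) = (i, j) ∧ (s', n') = (i', k)) → U.pos L (s, n) < U.pos L (s', n') →
      U.pos L' (s, n) < U.pos L' (s', n') := by
    intro s s' hss n n' hn hn' hne hlt
    have hm := hmono s s' hss n n' hn hn' hlt
    rw [hposL', hposL']
    by_cases hE : e s' ≤ n' ∧ ¬ e s ≤ n
    · rw [if_pos hE.1, if_neg hE.2] at hm
      -- `D` can drop only across the excluded overlap. Any pair other than the exchanged one that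
      -- spans this overlap also spans more than the interval of length `T`.
      have hgap : U.pos L (s, n) + T + 1 ≤ U.pos L (s', n') := by
        obtain ⟨hE1, hE2⟩ := hE
        rcases side_eq_or hi s with rfl | rfl
        · have hs' : s' = i' := (side_eq_or hi s').resolve_left fun h => hss h.symm
          subst hs'
          have g1 : U.pos L (s, n) ≤ U.pos L (s, j) := pos_le_pos hp (by omega) (by omega)
          have g2 : U.pos L (s', k) ≤ U.pos L (s', n') := pos_le_pos hp (by omega) (by omega)
          by_cases g3 : n = j
          · have g4 : U.pos L (s', k) < U.pos L (s', n') :=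
              pos_lt_pos hp (by
                rcases (by omega : k = n' ∨ k < n') with g | g
                · exact absurd ⟨by rw [g3], by rw [g]⟩ hne
                · exact g) hn'
            omega
          · have g4 : U.pos L (s, n) < U.pos L (s, j) := pos_lt_pos hp (by omega) (by omega)
            omega
        · have hs' : s' = i := (side_eq_or hi s').resolve_right fun h => hss h.symm
          subst hs'
          have g1 : U.pos L (s, n) ≤ U.pos L (s, k - 1) := pos_le_pos hp (by omega) (by omega)
          have g2 : U.pos L (s', j + 1) ≤ U.pos L (s', n') :=
            pos_le_pos hp (by omega) (by omega)
          omega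
      nlinarith
    · have hm' : U.pos D (s, n) ≤ U.pos D (s', n') := by
        split_ifs at hm <;> omega
      have := Nat.mul_le_mul_left (2 * T + 1) hm'
      omega
  have hends : ∀ s s' : Fin 2, s ≠ s' → ∀ n n' : ℕ, n ≤ (U s).length → n' ≤ (U s').length →
      U.pos L (s, n) = U.pos L (s', n') → U.pos L' (s, n) = U.pos L' (s', n') := by
    intro s s' hss n n' hn hn' heq
    rcases hs s s' hss n hn n' hn' heq with ⟨rfl, rfl⟩ | ⟨rfl, rfl⟩
    · simp
    · exact hbal.total s s'
  refine ⟨L', hbal, ?_, hflip, ?_⟩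
  · intro s s' hss n hn n' hn' heq
    rcases lt_trichotomy (U.pos L (s, n)) (U.pos L (s', n')) with h | h | h
    · by_cases hc1 : (s, n) = (i, j) ∧ (s', n') = (i', k)
      · rw [hc1.1, hc1.2] at heq; omega
      · have := hkeep s s' hss n n' hn hn' hc1 h; omega
    · exact hs s s' hss n hn n' hn' h
    · by_cases hc1 : (s', n') = (i, j) ∧ (s, n) = (i', k)
      · rw [hc1.1, hc1.2] at heq; omega
      · have := hkeep s' s hss.symm n' n hn' hn hc1 h; omega
  · rintro ⟨s, n⟩ ⟨s', n'⟩ hn hn' hc1 hc2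
    by_cases hss : s = s'
    · subst hss
      rw [pos_lt_pos_iff hp hn hn', pos_lt_pos_iff hp' hn hn']
    rcases lt_trichotomy (U.pos L (s, n)) (U.pos L (s', n')) with h | h | h
    · exact ⟨fun _ => h, fun _ => hkeep s s' hss n n' hn hn' hc1 h⟩
    · have := hends s s' hss n n' hn hn' h; omega
    · have := hkeep s' s (Ne.symm hss) n' n hn' hn hc2 h; omega

end WordEq

/-! ### Moving one boundary by repeated exchanges -/

namespace WordEq

variable {𝒳 : Type*}

/-- `L` is admissible and puts all boundaries other than `r` into the same order as `L₀`. -/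
structure AgreesOff (U : WordEq 𝒳) (r : Fin 2 × ℕ) (L₀ L : 𝒳 → ℕ) : Prop where
  balanced : U.Balanced L
  staggered : U.StaggeredBy L
  iff : ∀ s t : Fin 2 × ℕ, s.2 ≤ (U s.1).length → t.2 ≤ (U t.1).length → s ≠ r → t ≠ r →
    (U.pos L s < U.pos L t ↔ U.pos L₀ s < U.pos L₀ t)

/-- If no length function that agrees with `L₀` off the boundary `(i, j)` has a cyclic graph, then
this boundary can be moved into the interior of any occurrence `(i', k + 1)` of the other side that
meets the interval between its two neighbours. -/
theorem exists_move {U : WordEq 𝒳} {L₀ : 𝒳 → ℕ} (hL : U.Balanced L₀) (hs : U.StaggeredBy L₀)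
    {i i' : Fin 2} (hi : i ≠ i') {j k : ℕ} (hj : 1 ≤ j) (hj' : j < (U i).length)
    (hac : ∀ L, U.AgreesOff (i, j) L₀ L → ¬ U.Cyclic L) (hk : k + 1 ≤ (U i').length)
    (h1 : U.pos L₀ (i, j - 1) < U.pos L₀ (i', k + 1))
    (h2 : U.pos L₀ (i', k) < U.pos L₀ (i, j + 1)) :
    ∃ L, U.AgreesOff (i, j) L₀ L ∧ U.pos L (i', k) < U.pos L (i, j) ∧
      U.pos L (i, j) < U.pos L (i', k + 1) := by
  classical
  have hne : ∀ n, (i', n) ≠ (i, j) := fun n h => hi (congrArg Prod.fst h).symm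
  have hp1 : (i, j - 1) ≠ (i, j) := by simp; omega
  have hp2 : (i, j + 1) ≠ (i, j) := by simp
  -- `Q n`: the boundary can be moved into the occurrence `(i', n + 1)`
  let Q : ℕ → Prop := fun n => n + 1 ≤ (U i').length ∧ ∃ L, U.AgreesOff (i, j) L₀ L ∧
    U.pos L (i', n) < U.pos L (i, j) ∧ U.pos L (i, j) < U.pos L (i', n + 1)
  have hstart : ∃ n, Q n := by
    have hlt : U.pos L₀ (i, j) < U.pos L₀ (i', (U i').length) := by
      rw [hL.total i' i]
      exact pos_lt_pos hL.pos_letter hj' le_rfl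
    have hex : ∃ n, U.pos L₀ (i, j) < U.pos L₀ (i', n) := ⟨_, hlt⟩
    have hn0 : Nat.find hex ≠ 0 := fun h => by
      have := Nat.find_spec hex
      rw [h, pos_zero] at this
      omega
    have hnle : Nat.find hex ≤ (U i').length := Nat.find_min' hex hlt
    have hmin := Nat.find_min hex (m := Nat.find hex - 1) (by omega)
    refine ⟨Nat.find hex - 1, by omega, L₀, ⟨hL, hs, fun _ _ _ _ _ _ => Iff.rfl⟩, ?_, ?_⟩
    · refine lt_of_le_of_ne (not_lt.1 hmin) fun h => ?_
      rcases hs i i' hi j hj'.le _ (by omega) h.symm with h | h <;> omega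
    · rw [Nat.sub_add_cancel (by omega)]
      exact Nat.find_spec hex
  -- One exchange with `(i', n + 1)`. All boundaries except `(i, j)` keep their order, so `(i, j +
  -- 1)` still lies beyond `(i', k)` and the exchange is possible.
  have hup : ∀ n, n < k → Q n → Q (n + 1) := by
    rintro n hnk ⟨-, L, hLa, hl1, hl2⟩
    have hp := hLa.balanced.pos_letter
    have hnext : U.pos L (i', n + 1) < U.pos L (i, j + 1) := by
      have := (hLa.iff (i', k) (i, j + 1) (by simp only; omega) hj' (hne _) hp2).2 h2
      exact (pos_le_pos hp hnk (by omega)).trans_lt this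
    obtain ⟨L', hb, hst, hflip, hkeep⟩ := exists_swap hLa.balanced hLa.staggered (hac L hLa) hi hj
      hj' (k := n + 1) (by omega) (by omega) hl2 hnext (by simpa using hl1)
    refine ⟨by omega, L', ⟨hb, hst, fun s t hs ht hs' ht' => ?_⟩, hflip, ?_⟩
    · rw [hkeep s t hs ht (fun h => hs' h.1) (fun h => ht' h.1), hLa.iff s t hs ht hs' ht']
    · refine (hkeep (i, j) (i', n + 1 + 1) hj'.le (by simp only; omega) (by simp)
        (by simp [hi])).2 ?_
      exact hl2.trans (pos_lt_succ hp (by omega))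
  -- The mirror image: the boundary of the other side is now the smaller one, so the sides change
  -- roles in `exists_swap`.
  have hdown : ∀ n, k ≤ n → Q (n + 1) → Q n := by
    rintro n hnk ⟨hn, L, hLa, hl1, hl2⟩
    have hp := hLa.balanced.pos_letter
    have hprev : U.pos L (i, j - 1) < U.pos L (i', n + 1) := by
      have := (hLa.iff (i, j - 1) (i', k + 1) (by simp only; omega) hk hp1 (hne _)).2 h1
      exact this.trans_le (pos_le_pos hp (by omega) (by omega))
    obtain ⟨L', hb, hst, hflip, hkeep⟩ := exists_swap hLa.balanced hLa.staggered (hac L hLa)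
      hi.symm (j := n + 1) (k := j) (by omega) (by omega) hj hj' hl1 hl2 hprev
    refine ⟨by omega, L', ⟨hb, hst, fun s t hs ht hs' ht' => ?_⟩, ?_, hflip⟩
    · rw [hkeep s t hs ht (fun h => ht' h.2) (fun h => hs' h.2), hLa.iff s t hs ht hs' ht']
    · refine (hkeep (i', n) (i, j) (by simp only; omega) hj'.le (by simp) (by simp [hi])).2 ?_
      exact (pos_lt_succ hp (by omega)).trans hl1
  suffices Q k from this.2
  obtain ⟨n, hn⟩ := hstart
  rcases le_total n k with h | h
  · refine Nat.le_induction (P := fun m _ => m ≤ k → Q m) (fun _ => hn)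
      (fun m _ ih hm => hup m (by omega) (ih (by omega))) k h le_rfl
  · exact Nat.decreasingInduction' (P := Q) (fun m _ hm hQ => hdown m hm hQ) h hn

end WordEq

/-! ### Alternating walks and the splitting of closed walks -/

section Alternating

variable {V : Type*}

/-- A walk from `u` to `v` that alternates between `C`-edges and `M`-edges and begins and ends with
a `C`-edge. -/
def Alternating (C M : V → V → Prop) (u v : V) : Prop :=
  ∃ k, Relation.ReflTransGen (fun p q => ∃ w, C p w ∧ M w q) u k ∧ C k v

variable {C M : V → V → Prop}

theorem Alternating.single {u v : V} (h : C u v) : Alternating C M u v :=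
  ⟨u, .refl, h⟩

theorem Alternating.cons {u w u' v : V} (h₁ : C u w) (h₂ : M w u') (h : Alternating C M u' v) :
    Alternating C M u v := by
  obtain ⟨k, hk, hv⟩ := h
  exact ⟨k, .head ⟨w, h₁, h₂⟩ hk, hv⟩

theorem Alternating.head_induction {v : V} {P : V → Prop} (single : ∀ u, C u v → P u)
    (cons : ∀ u w u', C u w → M w u' → Alternating C M u' v → P u' → P u) {u : V}
    (h : Alternating C M u v) : P u := by
  obtain ⟨k, hk, hv⟩ := h
  induction hk using Relation.ReflTransGen.head_induction_on with
  | refl => exact single _ hv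
  | head h1 h2 ih =>
    obtain ⟨w, hw, hw'⟩ := h1
    exact cons _ _ _ hw hw' ⟨k, h2, hv⟩ ih

theorem Alternating.cases {u v : V} (h : Alternating C M u v) :
    C u v ∨ ∃ w u', C u w ∧ M w u' ∧ Alternating C M u' v := by
  exact h.head_induction (P := fun u => C u v ∨ ∃ w u', C u w ∧ M w u' ∧ Alternating C M u' v)
    (fun u h => .inl h) (fun u w u' h1 h2 h3 _ => .inr ⟨w, u', h1, h2, h3⟩)

theorem Alternating.symm (hC : ∀ {u v}, C u v → C v u) (hM : ∀ {u v}, M u v → M v u) {u v : V}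
    (h : Alternating C M u v) : Alternating C M v u := by
  refine h.head_induction (P := fun u => Alternating C M v u) (fun u h => .single (hC h)) ?_
  rintro u w u' h1 h2 - ⟨k, hk, hk'⟩
  exact ⟨w, hk.tail ⟨u', hk', hM h2⟩, hC h1⟩

/-- An alternating walk whose ends are joined by an `M`-edge closes up. -/
theorem Alternating.closed {u v : V} (h : Alternating C M u v) (hM : M v u) :
    Relation.TransGen (fun p q => ∃ w, C p w ∧ M w q) u u := by
  obtain ⟨k, hk, hk'⟩ := h
  exact Relation.TransGen.tail' hk ⟨v, hk', hM⟩

theorem Alternating.closed₂ {u u' v v' : V} (h₁ : Alternating C M u u') (h₂ : M u' v)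
    (h₃ : Alternating C M v v') (h₄ : M v' u) :
    Relation.TransGen (fun p q => ∃ w, C p w ∧ M w q) u u := by
  obtain ⟨k, hk, hk'⟩ := h₁
  obtain ⟨l, hl, hl'⟩ := h₃
  exact .trans (.tail' hk ⟨u', hk', h₂⟩) (.tail' hl ⟨v', hl', h₄⟩)

/-- A closed walk of `C`-`M`-steps, split at the `M`-edges that satisfy `X`: either there is a
closed walk without such edges, or one of two patterns of alternating walks without such edges. -/
theorem exists_pattern (X : V → V → Prop) (hX : ∀ c d, M c d → X c d → c ≠ d) {p : V}
    (h : Relation.TransGen (fun p q => ∃ w, C p w ∧ M w q) p p) :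
    (∃ q, Relation.TransGen (fun p q => ∃ w, C p w ∧ (M w q ∧ ¬ X w q)) q q) ∨
    (∃ d c, d ≠ c ∧ (∃ b, M b d ∧ X b d) ∧ (∃ b, M c b ∧ X c b) ∧
      Alternating C (fun w q => M w q ∧ ¬ X w q) d c) ∨
    ∃ d c, d ≠ c ∧ (M d c ∧ X d c) ∧
      Alternating C (fun w q => M w q ∧ ¬ X w q) d d ∧
      Alternating C (fun w q => M w q ∧ ¬ X w q) c c := by
  classical
  set S : V → V → Prop := fun p q => ∃ w, C p w ∧ (M w q ∧ ¬ X w q) with hS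
  set A : V → V → Prop := Alternating C (fun w q => M w q ∧ ¬ X w q) with hA
  -- A segment without special edges, followed by one special edge.
  set Y : V → V → Prop := fun p d => ∃ c, A p c ∧ M c d ∧ X c d with hY
  have hYhead : ∀ {r q d}, Relation.ReflTransGen S r q → Y q d → Y r d := by
    rintro r q d hr ⟨c, ⟨k, hk, hk'⟩, hM, hXc⟩
    exact ⟨c, ⟨k, hr.trans hk, hk'⟩, hM, hXc⟩
  have hsplit : ∀ {q}, Relation.TransGen (fun p q => ∃ w, C p w ∧ M w q) p q →
      Relation.TransGen S p q ∨ ∃ d, Relation.TransGen Y p d ∧ Relation.ReflTransGen S d q := by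
    intro q hq
    induction hq with
    | @single b h1 =>
      obtain ⟨w, hw, hw'⟩ := h1
      by_cases hx : X w b
      · exact .inr ⟨_, .single ⟨w, .single hw, hw', hx⟩, .refl⟩
      · exact .inl (.single ⟨w, hw, hw', hx⟩)
    | @tail a b _ h2 ih =>
      obtain ⟨w, hw, hw'⟩ := h2
      by_cases hx : X w b
      · refine .inr ⟨_, ?_, .refl⟩
        have hy : Y a b := ⟨w, .single hw, hw', hx⟩
        rcases ih with ih | ⟨d, hd, hd'⟩
        · exact .single (hYhead ih.to_reflTransGen hy)
        · exact hd.tail (hYhead hd' hy)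
      · rcases ih with ih | ⟨d, hd, hd'⟩
        · exact .inl (ih.tail ⟨w, hw, hw', hx⟩)
        · exact .inr ⟨d, hd, hd'.tail ⟨w, hw, hw', hx⟩⟩
  rcases hsplit h with h | ⟨d, hd, hd'⟩
  · exact .inl ⟨p, h⟩
  right
  -- Rotate the closed walk so that it starts just after a special edge: its last incomplete segment
  -- is prepended to the first one.
  have hdd : Relation.TransGen Y d d := by
    obtain ⟨e, he, he'⟩ := Relation.TransGen.head'_iff.1 hd
    exact Relation.TransGen.head'_iff.2 ⟨e, hYhead hd' he, he'⟩
  have hin : ∃ b, M b d ∧ X b d := by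
    obtain ⟨_, -, c, -, h1, h2⟩ := Relation.TransGen.tail'_iff.1 hdd
    exact ⟨c, h1, h2⟩
  obtain ⟨d₁, ⟨c, hc, hcM, hcX⟩, hd₁⟩ := Relation.TransGen.head'_iff.1 hdd
  by_cases hdc : d = c
  swap
  · exact .inl ⟨d, c, hdc, hin, ⟨d₁, hcM, hcX⟩, hc⟩
  subst hdc
  -- The first segment returns to its start. Special edges are not loops, so there is a second
  -- segment; it either has different ends or gives the pattern of two closed segments.
  have hne := hX _ _ hcM hcX
  obtain ⟨d₂, ⟨c₁, hc₁, hcM₁, hcX₁⟩, -⟩ :=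
    (Relation.ReflTransGen.cases_head hd₁).resolve_left hne.symm
  by_cases hdc : d₁ = c₁
  · subst hdc
    exact .inr ⟨d, d₁, hne, ⟨hcM, hcX⟩, hc, hc₁⟩
  · exact .inl ⟨d₁, c₁, hdc, ⟨d, hcM, hcX⟩, ⟨d₂, hcM₁, hcX₁⟩, hc₁⟩

end Alternating

/-! ### The substitution `x ↦ z x` and its effect on boundaries -/

namespace WordEq

variable {𝒳 : Type*}

/-- The first side begins with `x`, the second side with the shorter letter `z`. -/
structure Reducible (U : WordEq 𝒳) (L : 𝒳 → ℕ) (x z : 𝒳) : Prop where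
  letter_left : U.letter (0, 1) = some x
  letter_right : U.letter (1, 1) = some z
  pos_letter : ∀ y, 0 < L y
  lt : L z < L x

namespace Reducible

variable {U : WordEq 𝒳} {L : 𝒳 → ℕ} {x z : 𝒳}

theorem ne (h : U.Reducible L x z) : z ≠ x := fun e => by
  have := h.lt
  rw [e] at this
  omega

theorem ne_right (h : U.Reducible L x z) {d : Fin 2 × ℕ} (hd : U.letter d = some x) :
    d ≠ (1, 1) := by
  rintro rfl
  rw [h.letter_right] at hd
  exact h.ne (Option.some_injective _ hd)

theorem pos_right_lt (h : U.Reducible L x z) : U.pos L (1, 1) < U.pos L (0, 1) := by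
  rw [pos_succ (j := 0) L h.letter_right, pos_succ (j := 0) L h.letter_left]
  simpa using h.lt

/-- The leading `z` ends before the leading `x` does. Hence walks can enter or leave the letter that
is about to be deleted only through the leading `x` or along a mirror edge. -/
theorem eq_of_overlap_right (h : U.Reducible L x z) {w : Fin 2 × ℕ}
    (hw : U.Overlap L (1, 1) w) : w = (0, 1) := by
  obtain ⟨i, j⟩ := w
  obtain ⟨-, ⟨h1, h2⟩, h3, -, h4⟩ := hw
  have hi : i = 0 := ((side_eq_or (by decide : (0 : Fin 2) ≠ 1) i)).resolve_right fun e => h3 e.symm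
  subst hi
  simp only at h1 h2
  have := (pos_lt_pos_iff h.pos_letter (i := 0) (j := j - 1) (k := 1) (by omega) (by omega)).1
    (h4.trans h.pos_right_lt)
  have : j = 1 := by omega
  rw [this]

theorem left_mem (h : U.Reducible L x z) : ((0 : Fin 2), 1) ∈ U.boundaries := by
  obtain ⟨hn, -⟩ := List.getElem?_eq_some_iff.1 h.letter_left
  exact ⟨le_rfl, hn⟩

theorem two_le_of_letter (h : U.Reducible L x z) {p : Fin 2 × ℕ} (hp : p ∈ U.boundaries)
    (he : p ≠ (1, 1)) (hpx : U.letter p ≠ some x) : 2 ≤ p.2 :=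
  two_le hp (fun e => hpx (e ▸ h.letter_left)) he

end Reducible

variable [DecidableEq 𝒳]

section Subst

variable {x z : 𝒳}

theorem subst_append (u : List 𝒳) (v w : List 𝒳) : subst x u (v ++ w) = subst x u v ++ subst x u w :=
  List.flatMap_append

theorem length_subst (w : List 𝒳) : (subst x [z, x] w).length = w.length + w.count x := by
  induction w with
  | nil => rfl
  | cons y w ih =>
    have : subst x [z, x] (y :: w) = (if y = x then [z, x] else [y]) ++ subst x [z, x] w := rfl
    rw [this, List.length_append, ih, List.length_cons, List.count_cons]
    by_cases h : y = x
    · simp [h]; omega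
    · simp [h]; omega

theorem count_subst (hzx : z ≠ x) (w : List 𝒳) : (subst x [z, x] w).count x = w.count x := by
  induction w with
  | nil => rfl
  | cons y w ih =>
    have : subst x [z, x] (y :: w) = (if y = x then [z, x] else [y]) ++ subst x [z, x] w := rfl
    rw [this, List.count_append, ih, List.count_cons, add_comm]
    by_cases h : y = x
    · simp [h, hzx]
    · simp [h]

theorem take_subst (w : List 𝒳) {n : ℕ} (hn : n ≤ w.length) :
    (subst x [z, x] w).take (n + (w.take n).count x) = subst x [z, x] (w.take n) := by
  have h : (subst x [z, x] (w.take n)).length = n + (w.take n).count x := by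
    rw [length_subst, List.length_take, min_eq_left hn]
  conv_lhs => rw [← List.take_append_drop n w, subst_append]
  rw [List.take_append_of_le_length (by rw [h, List.take_append_drop]), List.take_of_length_le]
  rw [h, List.take_append_drop]

theorem getElem?_subst {w : List 𝒳} {n : ℕ} {y : 𝒳} (h : w[n]? = some y) {k : ℕ}
    (hk : k < (if y = x then [z, x] else [y]).length) :
    (subst x [z, x] w)[n + (w.take n).count x + k]? = (if y = x then [z, x] else [y])[k]? := by
  obtain ⟨hn, rfl⟩ := List.getElem?_eq_some_iff.1 h
  have hlen : (subst x [z, x] (w.take n)).length = n + (w.take n).count x := by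
    rw [length_subst, List.length_take, min_eq_left hn.le]
  have hw : subst x [z, x] w = subst x [z, x] (w.take n) ++
      ((if w[n] = x then [z, x] else [w[n]]) ++ subst x [z, x] (w.drop (n + 1))) := by
    conv_lhs => rw [← List.take_append_drop n w, List.drop_eq_getElem_cons hn, subst_append]
    rfl
  rw [hw, List.getElem?_append_right (by omega), List.getElem?_append_left (by omega), hlen]
  congr 1
  omega

end Subst

/-- The words of the result of the substitution `x ↦ z x` and the removal of the first letters. -/
def reduct (U : WordEq 𝒳) (x z : 𝒳) : WordEq 𝒳 := fun i => (subst x [z, x] (U i)).tail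

theorem mu_lt_mu {U : WordEq 𝒳} {x : 𝒳} {i : Fin 2} {j k : ℕ} (hj : 1 ≤ j) (hjk : j < k) :
    U.mu x (i, j) < U.mu x (i, k) := by
  have : ((U i).take j).count x ≤ ((U i).take k).count x :=
    ((List.take_sublist_take_left hjk.le).count_le x)
  simp only [mu]
  omega

/-- The boundary of the reduct that corresponds to a boundary of `U`. -/
def img (U : WordEq 𝒳) (x : 𝒳) (p : Fin 2 × ℕ) : Fin 2 × ℕ := (p.1, U.mu x p)

namespace Reducible

variable {U : WordEq 𝒳} {L : 𝒳 → ℕ} {x z : 𝒳}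

theorem mu_succ {i : Fin 2} {j : ℕ} {y : 𝒳}
    (hy : U.letter (i, j + 1) = some y) :
    U.mu x (i, j + 1) = j + ((U i).take j).count x + if y = x then 1 else 0 := by
  have h' : (U i)[j]? = some y := hy
  obtain ⟨hn, rfl⟩ := List.getElem?_eq_some_iff.1 h'
  show j + 1 + ((U i).take (j + 1)).count x - 1 = _
  rw [List.take_succ_eq_append_getElem hn, List.count_append, List.count_singleton]
  simp only [beq_iff_eq]
  omega

theorem mu_right (h : U.Reducible L x z) : U.mu x (1, 1) = 0 := by
  rw [mu_succ (j := 0) h.letter_right, if_neg h.ne]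
  simp

/-- The right end of the deleted letter becomes the left end of the new second side. Thus
`Lifts.iff` makes sense for all boundaries of `U`, including this one. -/
theorem img_right (h : U.Reducible L x z) : U.img x (1, 1) = (1, 0) := by
  rw [img, h.mu_right]

theorem img_left (h : U.Reducible L x z) : U.img x (0, 1) = (0, 1) := by
  rw [img, mu_succ (j := 0) h.letter_left, if_pos rfl]
  simp

theorem one_le_mu (h : U.Reducible L x z) {p : Fin 2 × ℕ} (hp : p ∈ U.boundaries)
    (hne : p ≠ (1, 1)) : 1 ≤ U.mu x p := by
  obtain ⟨y, hy⟩ := letter_eq_some hp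
  obtain ⟨i, j⟩ := p
  obtain ⟨j, rfl⟩ : ∃ k, j = k + 1 := ⟨j - 1, by have := hp.1; simp only at this; omega⟩
  rw [mu_succ hy]
  rcases Nat.eq_zero_or_pos j with rfl | hj
  · fin_cases i
    · have := h.letter_left
      simp_all
    · simp at hne
  · omega

theorem letter_img (h : U.Reducible L x z) {p : Fin 2 × ℕ} (hp : p ∈ U.boundaries)
    (hne : p ≠ (1, 1)) : (U.reduct x z).letter (U.img x p) = U.letter p := by
  obtain ⟨y, hy⟩ := letter_eq_some hp
  have h1 := h.one_le_mu hp hne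
  obtain ⟨i, j⟩ := p
  obtain ⟨j, rfl⟩ : ∃ k, j = k + 1 := ⟨j - 1, by have := hp.1; simp only at this; omega⟩
  have hy' : (U i)[j]? = some y := hy
  show (subst x [z, x] (U i)).tail[U.mu x (i, j + 1) - 1]? = _
  rw [List.getElem?_tail, Nat.sub_add_cancel h1, mu_succ hy, hy, getElem?_subst hy']
  · by_cases hyx : y = x <;> simp [hyx]
  · by_cases hyx : y = x <;> simp [hyx]

theorem img_mem (h : U.Reducible L x z) {p : Fin 2 × ℕ} (hp : p ∈ U.boundaries)
    (hne : p ≠ (1, 1)) : U.img x p ∈ (U.reduct x z).boundaries := by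
  have h1 := h.one_le_mu hp hne
  obtain ⟨y, hy⟩ := letter_eq_some hp
  have h2 := h.letter_img hp hne
  rw [hy] at h2
  obtain ⟨h3, -⟩ := List.getElem?_eq_some_iff.1 h2
  have h4 : (U.img x p).2 = U.mu x p := rfl
  exact ⟨h1, by omega⟩

theorem pred_img {p : Fin 2 × ℕ} (hp : p ∈ U.boundaries)
    (h2 : 2 ≤ p.2) (hpx : U.letter p ≠ some x) : pred (U.img x p) = U.img x (pred p) := by
  obtain ⟨y, hy⟩ := letter_eq_some hp
  obtain ⟨i, j⟩ := p
  obtain ⟨j, rfl⟩ : ∃ k, j = k + 1 := ⟨j - 1, by have := hp.1; simp only at this; omega⟩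
  have hyx : y ≠ x := fun e => hpx (e ▸ hy)
  simp only [pred, img]
  rw [mu_succ hy, if_neg hyx]
  rfl

theorem pred_pred_img {p : Fin 2 × ℕ} (hp : p ∈ U.boundaries)
    (h2 : 2 ≤ p.2) (hpx : U.letter p = some x) :
    pred (pred (U.img x p)) = U.img x (pred p) := by
  obtain ⟨i, j⟩ := p
  obtain ⟨j, rfl⟩ : ∃ k, j = k + 1 := ⟨j - 1, by have := hp.1; simp only at this; omega⟩
  simp only [pred, img]
  rw [mu_succ hpx, if_pos rfl]
  rfl

theorem two_le_img {p : Fin 2 × ℕ}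
    (h2 : 2 ≤ p.2) (hpx : U.letter p = some x) : 2 ≤ (U.img x p).2 := by
  obtain ⟨i, j⟩ := p
  obtain ⟨j, rfl⟩ : ∃ k, j = k + 1 := ⟨j - 1, by simp only at h2; omega⟩
  simp only at h2
  simp only [img]
  rw [mu_succ hpx, if_pos rfl]
  omega

theorem letter_pred_img {p : Fin 2 × ℕ}
    (h2 : 2 ≤ p.2) (hpx : U.letter p = some x) :
    (U.reduct x z).letter (pred (U.img x p)) = some z := by
  obtain ⟨i, j⟩ := p
  obtain ⟨j, rfl⟩ : ∃ k, j = k + 1 := ⟨j - 1, by simp only at h2; omega⟩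
  simp only at h2
  have hy' : (U i)[j]? = some x := hpx
  have := getElem?_subst (x := x) (z := z) hy' (k := 0) (by simp)
  show (subst x [z, x] (U i)).tail[U.mu x (i, j + 1) - 1 - 1]? = _
  rw [List.getElem?_tail, mu_succ hpx, if_pos rfl]
  simp only [if_true, List.getElem?_cons_zero] at this
  rw [← this]
  congr 1
  omega

theorem img_injOn {p q : Fin 2 × ℕ} (hp : p ∈ U.boundaries)
    (hq : q ∈ U.boundaries) (he : U.img x p = U.img x q) : p = q := by
  obtain ⟨i, j⟩ := p
  obtain ⟨i', k⟩ := q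
  obtain ⟨rfl, he⟩ : i = i' ∧ U.mu x (i, j) = U.mu x (i', k) := by
    simpa [img] using he
  rcases lt_trichotomy j k with hjk | hjk | hjk
  · have := mu_lt_mu (U := U) (x := x) (i := i) (j := j) hp.1 hjk; omega
  · rw [hjk]
  · have := mu_lt_mu (U := U) (x := x) (i := i) (j := k) hq.1 hjk; omega

/-- The boundary inside a block `z x` lies strictly between the images of two consecutive old
boundaries. It is new, so its place is not prescribed. -/
theorem img_ne_pred_img {p q : Fin 2 × ℕ} (hp : p ∈ U.boundaries)
    (hq : q ∈ U.boundaries) (h2 : 2 ≤ q.2) (hqx : U.letter q = some x) :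
    U.img x p ≠ pred (U.img x q) := by
  intro he
  have h3 : pred (pred (U.img x q)) = U.img x (pred q) := pred_pred_img hq h2 hqx
  have h4 := two_le_img h2 hqx
  obtain ⟨i, j⟩ := p
  obtain ⟨i', k⟩ := q
  simp only [img, pred, Prod.mk.injEq, true_and] at he h3 h4
  obtain ⟨rfl, he⟩ := he
  simp only at h2
  rcases (by omega : j < k - 1 ∨ j = k - 1 ∨ k ≤ j) with hjk | hjk | hjk
  · have := mu_lt_mu (U := U) (x := x) (i := i) (j := j) hp.1 hjk
    omega
  · rw [hjk] at he; omega
  · rcases hjk.eq_or_lt with rfl | hjk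
    · omega
    · have := mu_lt_mu (U := U) (x := x) (i := i) (j := k) (by omega) hjk
      omega

/-- Inserting or deleting `z ≠ x` does not affect the number of `x` in a prefix, so `nu` subtracts
exactly what `mu` has added. -/
theorem nu_img (h : U.Reducible L x z) {p : Fin 2 × ℕ} (hp : p ∈ U.boundaries) :
    (U.reduct x z).nu x (U.img x p) = p.2 := by
  obtain ⟨i, j⟩ := p
  obtain ⟨hj, hj'⟩ := hp
  simp only at hj hj'
  -- After the substitution both sides begin with `z`, so no `x` is lost with the first letter.
  have hhead : ∃ w, subst x [z, x] (U i) = z :: w := by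
    obtain ⟨y, hy⟩ := letter_eq_some (U := U) (p := (i, 1)) ⟨le_rfl, by simp only; omega⟩
    have hy' : (U i)[0]? = some y := hy
    have key := getElem?_subst (x := x) (z := z) hy' (k := 0) (by split_ifs <;> simp)
    have : (subst x [z, x] (U i))[0]? = some z := by
      have h1 : (if y = x then [z, x] else [y])[0]? = some z := by
        fin_cases i
        · have := h.letter_left.symm.trans hy
          simp at this
          simp [this]
        · have := h.letter_right.symm.trans hy
          simp at this
          simp [← this, h.ne]
      rw [← h1, ← key]
      simp
    cases hs : subst x [z, x] (U i) with
    | nil => simp [hs] at this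
    | cons y' w =>
      rw [hs] at this
      simp at this
      exact ⟨w, by rw [this]⟩
  obtain ⟨w, hw⟩ := hhead
  have ht := take_subst (x := x) (z := z) (U i) hj'
  have hm : U.mu x (i, j) + 1 = j + ((U i).take j).count x := by
    simp only [mu]; omega
  rw [← hm, hw, List.take_succ_cons] at ht
  have hc : (w.take (U.mu x (i, j))).count x = ((U i).take j).count x := by
    rw [← count_subst h.ne ((U i).take j), ← ht, List.count_cons_of_ne h.ne]
  have hr : U.reduct x z i = w := by simp [reduct, hw]
  simp only [nu, img, hr, hc]
  omega

end Reducible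

end WordEq

/-! ### Lifted length functions and the two parts of an occurrence of `x` -/

namespace WordEq

variable {𝒳 : Type*} [DecidableEq 𝒳]

/-- The length function `L'` puts the boundaries of the reduct that come from boundaries of `U`
into the order given by `L` on `U`. -/
structure Lifts (U : WordEq 𝒳) (L : 𝒳 → ℕ) (x z : 𝒳) (L' : 𝒳 → ℕ) : Prop where
  balanced : (U.reduct x z).Balanced L'
  staggered : (U.reduct x z).StaggeredBy L'
  iff : ∀ p ∈ U.boundaries, ∀ q ∈ U.boundaries,
    ((U.reduct x z).pos L' (U.img x p) < (U.reduct x z).pos L' (U.img x q) ↔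
      U.pos L p < U.pos L q)

/-- Alternating walks without mirror steps between occurrences of `x`. -/
def Walk (U : WordEq 𝒳) (L : 𝒳 → ℕ) (x : 𝒳) : Fin 2 × ℕ → Fin 2 × ℕ → Prop :=
  Alternating (U.Overlap L) fun p q => U.Twin p q ∧ ¬ U.letter p = some x

/-- The first or last inner vertex of a walk at an occurrence `d` of `x`; the flag tells that the
walk passes from `d` through the cancelled first letter of the second side. -/
def Handle (U : WordEq 𝒳) (L : 𝒳 → ℕ) (x : 𝒳) (d : Fin 2 × ℕ) (η : Bool × (Fin 2 × ℕ)) : Prop :=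
  η.2 ∈ U.boundaries ∧ η.2 ≠ (1, 1) ∧ U.letter η.2 ≠ some x ∧
    ((η.1 = true ∧ d = (0, 1) ∧ U.letter η.2 = U.letter (1, 1)) ∨
      (η.1 = false ∧ U.Overlap L d η.2))

/-- A boundary of the reduct from which the lift of a walk with the given handle can start. -/
def Realizes (U : WordEq 𝒳) (x z : 𝒳) (L' : 𝒳 → ℕ) (η : Bool × (Fin 2 × ℕ)) (d : Fin 2 × ℕ) :
    Prop :=
  (η.1 = true ∧ d = U.img x η.2) ∨ (η.1 = false ∧ (U.reduct x z).Overlap L' d (U.img x η.2))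

/-- The boundaries of the reduct that can play the role of an occurrence `d` of `x`. -/
def IsLift (U : WordEq 𝒳) (x : 𝒳) (d d' : Fin 2 × ℕ) : Prop :=
  d' = U.img x d ∨ (d ≠ (0, 1) ∧ d' = pred (U.img x d)) ∨
    (d = (0, 1) ∧ ∃ f ∈ U.boundaries, f ≠ (1, 1) ∧ U.letter f = U.letter (1, 1) ∧ d' = U.img x f)

namespace Reducible

variable {U : WordEq 𝒳} {L : 𝒳 → ℕ} {x z : 𝒳}

theorem pred_img_mem (h : U.Reducible L x z) {c : Fin 2 × ℕ} (hc : c ∈ U.boundaries)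
    (h2 : 2 ≤ c.2) (hcx : U.letter c = some x) : pred (U.img x c) ∈ (U.reduct x z).boundaries :=
  pred_mem (h.img_mem hc (h.ne_right hcx)) (two_le_img h2 hcx)

theorem img_le_length (h : U.Reducible L x z) {p : Fin 2 × ℕ} (hp : p ∈ U.boundaries) :
    (U.img x p).2 ≤ (U.reduct x z (U.img x p).1).length := by
  by_cases he : p = (1, 1)
  · subst he
    simp [h.img_right]
  · exact (h.img_mem hp he).2

theorem twin_img (h : U.Reducible L x z) {p q : Fin 2 × ℕ} (hpq : U.Twin p q) (hp : p ≠ (1, 1))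
    (hq : q ≠ (1, 1)) : (U.reduct x z).Twin (U.img x p) (U.img x q) :=
  ⟨h.img_mem hpq.1 hp, h.img_mem hpq.2.1 hq,
    fun e => hpq.2.2.1 (img_injOn hpq.1 hpq.2.1 e), by
      rw [h.letter_img hpq.1 hp, h.letter_img hpq.2.1 hq, hpq.2.2.2]⟩

theorem overlap_img (h : U.Reducible L x z) {L' : 𝒳 → ℕ} (hl : U.Lifts L x z L')
    {p q : Fin 2 × ℕ} (hpq : U.Overlap L p q) (hp : p ≠ (1, 1)) (hq : q ≠ (1, 1))
    (hpx : U.letter p ≠ some x) (hqx : U.letter q ≠ some x) :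
    (U.reduct x z).Overlap L' (U.img x p) (U.img x q) := by
  obtain ⟨h1, h2, h3, h4, h5⟩ := hpq
  have hp2 := h.two_le_of_letter h1 hp hpx
  have hq2 := h.two_le_of_letter h2 hq hqx
  refine ⟨h.img_mem h1 hp, h.img_mem h2 hq, h3, ?_, ?_⟩
  · rw [pred_img h1 hp2 hpx]
    exact (hl.iff _ (pred_mem h1 hp2) _ h2).2 h4
  · rw [pred_img h2 hq2 hqx]
    exact (hl.iff _ (pred_mem h2 hq2) _ h1).2 h5

theorem pos_img_left_pred (h : U.Reducible L x z) (L' : 𝒳 → ℕ) :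
    (U.reduct x z).pos L' (pred (U.img x (0, 1))) = 0 := by
  rw [h.img_left]
  exact pos_zero _ _ _

/-- An occurrence of `x` has a part that overlaps a given old occurrence of another letter. -/
theorem exists_realizer (h : U.Reducible L x z) {L' : 𝒳 → ℕ} (hl : U.Lifts L x z L')
    {d : Fin 2 × ℕ} (hd : d ∈ U.boundaries) (hdx : U.letter d = some x)
    {η : Bool × (Fin 2 × ℕ)} (hη : U.Handle L x d η) :
    ∃ d', U.IsLift x d d' ∧ U.Realizes x z L' η d' := by
  obtain ⟨hm, hne, hk, ⟨ht, rfl, hlet⟩ | ⟨hf, ho⟩⟩ := hη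
  · exact ⟨_, .inr (.inr ⟨rfl, η.2, hm, hne, hlet, rfl⟩), .inl ⟨ht, rfl⟩⟩
  have hm' := h.img_mem hm hne
  have hd' := h.img_mem hd (h.ne_right hdx)
  have hk2 := h.two_le_of_letter hm hne hk
  have hpk := pred_img hm hk2 hk
  obtain ⟨-, -, h3, h4, h5⟩ := ho
  have g5 : (U.reduct x z).pos L' (pred (U.img x η.2)) < (U.reduct x z).pos L' (U.img x d) := by
    rw [hpk]
    exact (hl.iff _ (pred_mem hm hk2) _ hd).2 h5
  by_cases hda : d = (0, 1)
  · subst hda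
    refine ⟨_, .inl rfl, .inr ⟨hf, hd', hm', h3, ?_, g5⟩⟩
    rw [h.pos_img_left_pred]
    exact pos_pos_of_mem hl.balanced.pos_letter hm'
  have hd2 := two_le hd hda (h.ne_right hdx)
  -- If the `x`-part starts only after the old occurrence has ended, then the `z`-part meets it.
  by_cases hr : (U.reduct x z).pos L' (pred (U.img x d)) < (U.reduct x z).pos L' (U.img x η.2)
  · exact ⟨_, .inl rfl, .inr ⟨hf, hd', hm', h3, hr, g5⟩⟩
  · refine ⟨_, .inr (.inl ⟨hda, rfl⟩), .inr ⟨hf, h.pred_img_mem hd hd2 hdx, hm', h3, ?_, ?_⟩⟩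
    · rw [pred_pred_img hd hd2 hdx]
      exact (hl.iff _ (pred_mem hd hd2) _ hm).2 h4
    · exact (pos_pred_lt hl.balanced.pos_letter hm').trans_le (not_lt.1 hr)

/-- A part of an occurrence `d` of `x` that meets an overlapping occurrence `c` of `x`. -/
theorem exists_part (h : U.Reducible L x z) {L' : 𝒳 → ℕ} (hl : U.Lifts L x z L')
    {d c : Fin 2 × ℕ} (hdx : U.letter d = some x) (ho : U.Overlap L d c) (hc2 : 2 ≤ c.2) :
    ∃ d', U.IsLift x d d' ∧ d' ∈ (U.reduct x z).boundaries ∧ d'.1 = d.1 ∧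
      (U.reduct x z).pos L' (U.img x (pred c)) < (U.reduct x z).pos L' d' ∧
      (U.reduct x z).pos L' (pred d') < (U.reduct x z).pos L' (U.img x c) := by
  obtain ⟨hd, hc, h3, h4, h5⟩ := ho
  have hd' := h.img_mem hd (h.ne_right hdx)
  have hpc := pred_mem hc hc2
  have g4 := (hl.iff _ hpc _ hd).2 h5
  have g6 : (U.reduct x z).pos L' (U.img x (pred c)) < (U.reduct x z).pos L' (U.img x c) :=
    (hl.iff _ hpc _ hc).2 (pos_pred_lt h.pos_letter hc)
  by_cases hda : d = (0, 1)
  · subst hda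
    refine ⟨_, .inl rfl, hd', rfl, g4, ?_⟩
    rw [h.pos_img_left_pred]
    omega
  have hd2 := two_le hd hda (h.ne_right hdx)
  by_cases hr : (U.reduct x z).pos L' (U.img x (pred c)) <
      (U.reduct x z).pos L' (pred (U.img x d))
  · refine ⟨_, .inr (.inl ⟨hda, rfl⟩), h.pred_img_mem hd hd2 hdx, rfl, hr, ?_⟩
    rw [pred_pred_img hd hd2 hdx]
    exact (hl.iff _ (pred_mem hd hd2) _ hc).2 h4
  · exact ⟨_, .inl rfl, hd', rfl, g4, (not_lt.1 hr).trans_lt g6⟩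

theorem isLift_ne (h : U.Reducible L x z) {d c d' : Fin 2 × ℕ} (hd : d ∈ U.boundaries)
    (hdx : U.letter d = some x) (hc : c ∈ U.boundaries) (hcx : U.letter c = some x)
    (hca : c ≠ (0, 1)) (hdc : d ≠ c) (hl : U.IsLift x d d') :
    d' ≠ U.img x c ∧ d' ≠ pred (U.img x c) := by
  have hc2 := two_le hc hca (h.ne_right hcx)
  rcases hl with rfl | ⟨hda, rfl⟩ | ⟨rfl, f, hf, hfe, hfl, rfl⟩
  · exact ⟨fun e => hdc (img_injOn hd hc e), img_ne_pred_img hd hc hc2 hcx⟩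
  · have hd2 := two_le hd hda (h.ne_right hdx)
    refine ⟨(img_ne_pred_img hc hd hd2 hdx).symm, fun e => hdc ?_⟩
    have e' := congrArg pred e
    rw [pred_pred_img hd hd2 hdx, pred_pred_img hc hc2 hcx] at e'
    have e2 := img_injOn (pred_mem hd hd2) (pred_mem hc hc2) e'
    simp only [pred, Prod.mk.injEq] at e2
    exact Prod.ext e2.1 (by omega)
  · refine ⟨fun e => ?_, img_ne_pred_img hf hc hc2 hcx⟩
    have := img_injOn hf hc e
    rw [this, hcx, h.letter_right] at hfl
    exact h.ne (Option.some_injective _ hfl).symm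

theorem isLift_mem (h : U.Reducible L x z) {d d' : Fin 2 × ℕ} (hd : d ∈ U.boundaries)
    (hdx : U.letter d = some x) (hl : U.IsLift x d d') :
    d' ∈ (U.reduct x z).boundaries ∧
      ((U.reduct x z).letter d' = some x ∨ (U.reduct x z).letter d' = some z) := by
  rcases hl with rfl | ⟨hda, rfl⟩ | ⟨rfl, f, hf, hfe, hfl, rfl⟩
  · exact ⟨h.img_mem hd (h.ne_right hdx), .inl (by rw [h.letter_img hd (h.ne_right hdx), hdx])⟩
  · have hd2 := two_le hd hda (h.ne_right hdx)
    exact ⟨h.pred_img_mem hd hd2 hdx, .inr (letter_pred_img hd2 hdx)⟩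
  · exact ⟨h.img_mem hf hfe, .inr (by rw [h.letter_img hf hfe, hfl, h.letter_right])⟩

theorem isLift_twin_img (h : U.Reducible L x z) {d c d' : Fin 2 × ℕ} (hd : d ∈ U.boundaries)
    (hdx : U.letter d = some x) (hc : c ∈ U.boundaries) (hcx : U.letter c = some x)
    (hca : c ≠ (0, 1)) (hdc : d ≠ c) (hl : U.IsLift x d d')
    (hx : (U.reduct x z).letter d' = some x) : (U.reduct x z).Twin d' (U.img x c) :=
  ⟨(h.isLift_mem hd hdx hl).1, h.img_mem hc (h.ne_right hcx),
    (h.isLift_ne hd hdx hc hcx hca hdc hl).1, by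
      rw [hx, h.letter_img hc (h.ne_right hcx), hcx]⟩

theorem isLift_twin_pred_img (h : U.Reducible L x z) {d c d' : Fin 2 × ℕ} (hd : d ∈ U.boundaries)
    (hdx : U.letter d = some x) (hc : c ∈ U.boundaries) (hcx : U.letter c = some x)
    (hca : c ≠ (0, 1)) (hdc : d ≠ c) (hl : U.IsLift x d d')
    (hz : (U.reduct x z).letter d' = some z) : (U.reduct x z).Twin d' (pred (U.img x c)) :=
  have hc2 := two_le hc hca (h.ne_right hcx)
  ⟨(h.isLift_mem hd hdx hl).1, h.pred_img_mem hc hc2 hcx,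
    (h.isLift_ne hd hdx hc hcx hca hdc hl).2, by
      rw [hz, letter_pred_img hc2 hcx]⟩

/-- The boundary that may move is inside the block of `c`, so no condition in `Lifts.iff` involves
it. -/
theorem lifts_of_agreesOff (h : U.Reducible L x z) {L₀ L' : 𝒳 → ℕ} (hl : U.Lifts L x z L₀)
    {c : Fin 2 × ℕ} (hc : c ∈ U.boundaries) (hc2 : 2 ≤ c.2) (hcx : U.letter c = some x)
    (ha : (U.reduct x z).AgreesOff (pred (U.img x c)) L₀ L') : U.Lifts L x z L' where
  balanced := ha.balanced
  staggered := ha.staggered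
  iff p hp q hq := by
    rw [ha.iff _ _ (h.img_le_length hp) (h.img_le_length hq) (img_ne_pred_img hp hc hc2 hcx)
      (img_ne_pred_img hq hc hc2 hcx), hl.iff p hp q hq]

/-- If all lifts are acyclic, then the boundary between the two parts of an occurrence `c` of `x`
can be moved into any occurrence `t` that meets `c`. -/
theorem exists_target (h : U.Reducible L x z) {L₀ : 𝒳 → ℕ} (hl : U.Lifts L x z L₀)
    (hac : ∀ L', U.Lifts L x z L' → ¬ (U.reduct x z).Cyclic L')
    {c t : Fin 2 × ℕ} (hc : c ∈ U.boundaries) (hca : c ≠ (0, 1)) (hcx : U.letter c = some x)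
    (ht : t ∈ (U.reduct x z).boundaries) (htc : t.1 ≠ c.1)
    (h1 : (U.reduct x z).pos L₀ (U.img x (pred c)) < (U.reduct x z).pos L₀ t)
    (h2 : (U.reduct x z).pos L₀ (pred t) < (U.reduct x z).pos L₀ (U.img x c)) :
    ∃ L', U.Lifts L x z L' ∧ (U.reduct x z).AgreesOff (pred (U.img x c)) L₀ L' ∧
      (U.reduct x z).pos L' (pred t) < (U.reduct x z).pos L' (pred (U.img x c)) ∧
      (U.reduct x z).pos L' (pred (U.img x c)) < (U.reduct x z).pos L' t ∧
      (U.reduct x z).Overlap L' t (U.img x c) ∧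
      (U.reduct x z).Overlap L' t (pred (U.img x c)) := by
  have hc2 := two_le hc hca (h.ne_right hcx)
  have hZ := h.pred_img_mem hc hc2 hcx
  have hX := h.img_mem hc (h.ne_right hcx)
  have hpp := pred_pred_img hc hc2 hcx
  have hX2 := two_le_img hc2 hcx
  obtain ⟨s, k⟩ := t
  obtain ⟨k, rfl⟩ : ∃ m, k = m + 1 := ⟨k - 1, by have := ht.1; simp only at this; omega⟩
  have hside : (pred (U.img x c)).1 ≠ s := htc.symm
  -- The neighbours of the moving boundary on its side are the ends of the block, `img x (pred c)`
  -- and `img x c`, so it can reach every occurrence that meets the block.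
  obtain ⟨L', ha, g1, g2⟩ := exists_move (k := k) (j := (pred (U.img x c)).2)
    hl.balanced hl.staggered hside hZ.1
    (by simp only [pred]; have := hX.2; omega)
    (fun L' ha => hac L' (h.lifts_of_agreesOff hl hc hc2 hcx ha)) ht.2
    (by rw [← hpp] at h1; exact h1)
    (by
      have : (pred (U.img x c)).2 + 1 = (U.img x c).2 := by simp only [pred]; omega
      rw [this]
      exact h2)
  have hl' := h.lifts_of_agreesOff hl hc hc2 hcx ha
  have hp := hl'.balanced.pos_letter
  refine ⟨L', hl', ha, g1, g2, ⟨ht, hX, htc, ?_, ?_⟩, ⟨ht, hZ, htc, g1, ?_⟩⟩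
  · exact lt_trans g1 (pos_pred_lt hp hX)
  · exact g2
  · exact (pos_pred_lt hp hZ).trans g2

end Reducible

end WordEq

/-! ### Lifting walks and cycles to the reduct -/

namespace WordEq

namespace Reducible

variable {𝒳 : Type*} {U : WordEq 𝒳} {L : 𝒳 → ℕ} {x z : 𝒳}

theorem walk_symm {d c : Fin 2 × ℕ} (hw : U.Walk L x d c) : U.Walk L x c d :=
  Alternating.symm (fun h => h.symm)
    (fun {u v} (h : U.Twin u v ∧ ¬ U.letter u = some x) => ⟨h.1.symm, h.1.2.2.2 ▸ h.2⟩) hw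

/-- A handle at an occurrence of `x` other than the first letter is an overlap. -/
theorem handle_of_ne {c : Fin 2 × ℕ} {θ : Bool × (Fin 2 × ℕ)} (hθ : U.Handle L x c θ)
    (hca : c ≠ (0, 1)) : θ.1 = false ∧ U.Overlap L c θ.2 ∧ θ.2 ∈ U.boundaries ∧ θ.2 ≠ (1, 1) ∧
      U.letter θ.2 ≠ some x := by
  obtain ⟨h1, h2, h3, ⟨-, h4, -⟩ | ⟨h4, h5⟩⟩ := hθ
  · exact absurd h4 hca
  · exact ⟨h4, h5, h1, h2, h3⟩

variable [DecidableEq 𝒳]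

/-- A walk from an old occurrence of another letter to an occurrence of `x` lifts to alternating
walks of the reduct to all boundaries that realize its last handle. -/
theorem walk_from_old (h : U.Reducible L x z) {u c : Fin 2 × ℕ} (hw : U.Walk L x u c)
    (hu : u ≠ (1, 1)) (hux : U.letter u ≠ some x) :
    ∃ θ, U.Handle L x c θ ∧ ∀ L', U.Lifts L x z L' → ∀ c', U.Realizes x z L' θ c' →
      Alternating ((U.reduct x z).Overlap L') (U.reduct x z).Twin (U.img x u) c' := by
  refine hw.head_induction (P := fun u => u ≠ (1, 1) → U.letter u ≠ some x →
    ∃ θ, U.Handle L x c θ ∧ ∀ L', U.Lifts L x z L' → ∀ c', U.Realizes x z L' θ c' →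
      Alternating ((U.reduct x z).Overlap L') (U.reduct x z).Twin (U.img x u) c') ?_ ?_ hu hux
  · intro u huc hu hux
    refine ⟨(false, u), ⟨huc.1, hu, hux, .inr ⟨rfl, huc.symm⟩⟩, fun L' hl c' hc' => ?_⟩
    rcases hc' with ⟨hc', -⟩ | ⟨-, hc'⟩
    · simp at hc'
    · exact .single hc'.symm
  · intro u w u' huw hwu' hrest ih hu hux
    have hwe : w ≠ (1, 1) := by
      rintro rfl
      exact hux (h.eq_of_overlap_right huw.symm ▸ h.letter_left)
    have hwx := hwu'.2
    have hux' : U.letter u' ≠ some x := hwu'.1.2.2.2 ▸ hwx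
    by_cases hu'e : u' = (1, 1)
    · subst hu'e
      -- From the deleted letter the walk can only proceed to the leading `x`, and there it must end
      -- because mirror steps between occurrences of `x` are excluded. The lift stops one overlap
      -- earlier, at the twin `w` of the deleted letter.
      have hca : c = (0, 1) := by
        rcases hrest.cases with hr | ⟨w', u'', hr, hr', -⟩
        · exact h.eq_of_overlap_right hr
        · exact absurd (h.eq_of_overlap_right hr ▸ h.letter_left) hr'.2
      refine ⟨(true, w), ⟨huw.2.1, hwe, hwx, .inl ⟨rfl, hca, hwu'.1.2.2.2⟩⟩,
        fun L' hl c' hc' => ?_⟩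
      rcases hc' with ⟨-, rfl⟩ | ⟨hc', -⟩
      · exact .single (h.overlap_img hl huw hu hwe hux hwx)
      · simp at hc'
    · obtain ⟨θ, hθ, hθ'⟩ := ih hu'e hux'
      refine ⟨θ, hθ, fun L' hl c' hc' => ?_⟩
      exact .cons (h.overlap_img hl huw hu hwe hux hwx) (h.twin_img hwu'.1 hwe hu'e)
        (hθ' L' hl c' hc')

/-- A walk between two occurrences of `x` lifts to alternating walks of the reduct between all
boundaries that realize the handles of the walk. -/
theorem walk_lift (h : U.Reducible L x z) {d c : Fin 2 × ℕ} (hw : U.Walk L x d c) :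
    U.Overlap L d c ∨ ∃ η θ, U.Handle L x d η ∧ U.Handle L x c θ ∧
      ∀ L', U.Lifts L x z L' → ∀ d' c', U.Realizes x z L' η d' → U.Realizes x z L' θ c' →
        Alternating ((U.reduct x z).Overlap L') (U.reduct x z).Twin d' c' := by
  rcases hw.cases with hdc | ⟨w, u, hdw, hwu, hrest⟩
  · exact .inl hdc
  right
  have hwx := hwu.2
  have hux : U.letter u ≠ some x := hwu.1.2.2.2 ▸ hwx
  by_cases hwe : w = (1, 1)
  · subst hwe
    have hue : u ≠ (1, 1) := hwu.1.2.2.1.symm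
    -- The walk starts at the leading `x` and passes through the deleted letter; its lift starts at
    -- the twin `u` of that letter.
    have hda := h.eq_of_overlap_right hdw.symm
    obtain ⟨θ, hθ, hθ'⟩ := h.walk_from_old hrest hue hux
    refine ⟨(true, u), θ, ⟨hwu.1.2.1, hue, hux, .inl ⟨rfl, hda, hwu.1.2.2.2.symm⟩⟩, hθ, ?_⟩
    rintro L' hl d' c' (⟨-, rfl⟩ | ⟨hd', -⟩) hc'
    · exact hθ' L' hl c' hc'
    · simp at hd'
  by_cases hue : u = (1, 1)
  · subst hue
    have hca : c = (0, 1) := by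
      rcases hrest.cases with hr | ⟨w', u'', hr, hr', -⟩
      · exact h.eq_of_overlap_right hr
      · exact absurd (h.eq_of_overlap_right hr ▸ h.letter_left) hr'.2
    refine ⟨(false, w), (true, w), ⟨hdw.2.1, hwe, hwx, .inr ⟨rfl, hdw⟩⟩,
      ⟨hdw.2.1, hwe, hwx, .inl ⟨rfl, hca, hwu.1.2.2.2⟩⟩, ?_⟩
    rintro L' hl d' c' (⟨hd', -⟩ | ⟨-, hd'⟩) (⟨-, rfl⟩ | ⟨hc', -⟩)
    · simp at hd'
    · simp at hd'
    · exact .single hd'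
    · simp at hc'
  · obtain ⟨θ, hθ, hθ'⟩ := h.walk_from_old hrest hue hux
    refine ⟨(false, w), θ, ⟨hdw.2.1, hwe, hwx, .inr ⟨rfl, hdw⟩⟩, hθ, ?_⟩
    rintro L' hl d' c' (⟨hd', -⟩ | ⟨-, hd'⟩) hc'
    · simp at hd'
    · exact .cons hd' (h.twin_img hwu.1 hwe hue) (hθ' L' hl c' hc')

/-- A closed walk without mirror steps between occurrences of `x` lifts to the reduct. -/
theorem cyclic_of_closed (h : U.Reducible L x z) {L' : 𝒳 → ℕ} (hl : U.Lifts L x z L')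
    {q : Fin 2 × ℕ} (hq : Relation.TransGen
      (fun p q => ∃ w, U.Overlap L p w ∧ (U.Twin w q ∧ ¬ U.letter w = some x)) q q) :
    (U.reduct x z).Cyclic L' := by
  set S : Fin 2 × ℕ → Fin 2 × ℕ → Prop :=
    fun p q => ∃ w, U.Overlap L p w ∧ (U.Twin w q ∧ ¬ U.letter w = some x) with hS
  have hin : ∀ {p r}, S p r → U.letter r ≠ some x := by
    rintro p r ⟨w, -, hw, hwx⟩
    exact hw.2.2.2 ▸ hwx
  -- A step from the deleted letter would have to use a mirror edge at the leading `x`, so the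
  -- closed walk avoids the deleted letter.
  have hout : ∀ {p r}, S p r → p ≠ (1, 1) := by
    rintro p r ⟨w, hw, -, hwx⟩ rfl
    exact hwx (h.eq_of_overlap_right hw ▸ h.letter_left)
  have hstep : ∀ {p r}, S p r → U.letter p ≠ some x → p ≠ (1, 1) → r ≠ (1, 1) →
      (U.reduct x z).Step L' (U.img x p) (U.img x r) := by
    rintro p r ⟨w, hw, hw', hwx⟩ hpx hp hr
    have hwe : w ≠ (1, 1) := by
      rintro rfl
      exact hpx (h.eq_of_overlap_right hw.symm ▸ h.letter_left)
    exact ⟨_, h.overlap_img hl hw hp hwe hpx hwx, h.twin_img hw' hwe hr⟩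
  have key : ∀ {p r}, Relation.TransGen S p r → U.letter p ≠ some x → r ≠ (1, 1) →
      Relation.TransGen ((U.reduct x z).Step L') (U.img x p) (U.img x r) := by
    intro p r hpr hpx
    induction hpr with
    | single h1 => exact fun hr => .single (hstep h1 hpx (hout h1) hr)
    | @tail a b h1 h2 ih =>
      intro hr
      obtain ⟨_, -, h3⟩ := Relation.TransGen.tail'_iff.1 h1
      exact (ih (hout h2)).tail (hstep h2 (hin h3) (hout h2) hr)
  obtain ⟨_, h1, -⟩ := Relation.TransGen.head'_iff.1 hq
  obtain ⟨_, -, h2⟩ := Relation.TransGen.tail'_iff.1 hq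
  exact ⟨_, key hq (hin h2) (hout h1)⟩

/-- A walk between different occurrences of `x` gives a cyclic lift. -/
theorem exists_cyclic_of_walk (h : U.Reducible L x z) {L₀ : 𝒳 → ℕ} (hl : U.Lifts L x z L₀)
    {d c : Fin 2 × ℕ} (hd : d ∈ U.boundaries) (hdx : U.letter d = some x)
    (hc : c ∈ U.boundaries) (hcx : U.letter c = some x) (hca : c ≠ (0, 1)) (hdc : d ≠ c)
    (hw : U.Walk L x d c) : ∃ L', U.Lifts L x z L' ∧ (U.reduct x z).Cyclic L' := by
  by_contra! hac
  have hc2 := two_le hc hca (h.ne_right hcx)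
  have hpc := pred_mem hc hc2
  -- a lift at `d` that is joined to both parts of `c` closes up
  have close : ∀ L', U.Lifts L x z L' → ∀ d', U.IsLift x d d' →
      Alternating ((U.reduct x z).Overlap L') (U.reduct x z).Twin d' (U.img x c) →
      Alternating ((U.reduct x z).Overlap L') (U.reduct x z).Twin d' (pred (U.img x c)) →
      False := by
    intro L' hl' d' hd' h1 h2
    rcases (h.isLift_mem hd hdx hd').2 with hx | hz
    · exact hac L' hl' ⟨_, h1.closed (h.isLift_twin_img hd hdx hc hcx hca hdc hd' hx).symm⟩
    · exact hac L' hl' ⟨_, h2.closed (h.isLift_twin_pred_img hd hdx hc hcx hca hdc hd' hz).symm⟩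
  rcases h.walk_lift hw with ho | ⟨η, θ, hη, hθ, hlift⟩
  · obtain ⟨d', hd', hm, hside, h1, h2⟩ := h.exists_part hl hdx ho hc2
    obtain ⟨L', hl', -, -, -, h3, h4⟩ := h.exists_target hl hac hc hca hcx hm
      (hside ▸ ho.2.2.1) h1 h2
    exact close L' hl' d' hd' (.single h3) (.single h4)
  · obtain ⟨hf, ho, hk, hke, hkx⟩ := handle_of_ne hθ hca
    have hk2 := h.two_le_of_letter hk hke hkx
    -- Once the boundary inside `c` lies within the handle at `c`, both parts of `c` overlap this
    -- handle. The realizer at `d` is chosen afterwards, for the new lengths.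
    obtain ⟨L', hl', -, -, -, h3, h4⟩ := h.exists_target hl hac hc hca hcx (h.img_mem hk hke)
      ho.2.2.1.symm ((hl.iff _ hpc _ hk).2 ho.2.2.2.1)
      (by rw [pred_img hk hk2 hkx]; exact (hl.iff _ (pred_mem hk hk2) _ hc).2 ho.2.2.2.2)
    obtain ⟨d', hd', hr⟩ := h.exists_realizer hl' hd hdx hη
    exact close L' hl' d' hd' (hlift L' hl' d' _ hr (.inr ⟨hf, h3.symm⟩))
      (hlift L' hl' d' _ hr (.inr ⟨hf, h4.symm⟩))

/-- Realizers at one occurrence of `x` stay realizers when the boundary between the two parts of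
another occurrence is moved. -/
theorem realizes_of_agreesOff (h : U.Reducible L x z) {L₀ L' : 𝒳 → ℕ}
    {d c d' : Fin 2 × ℕ} (hd : d ∈ U.boundaries) (hdx : U.letter d = some x)
    (hc : c ∈ U.boundaries) (hcx : U.letter c = some x) (hca : c ≠ (0, 1)) (hdc : d ≠ c)
    (ha : (U.reduct x z).AgreesOff (pred (U.img x c)) L₀ L') {η : Bool × (Fin 2 × ℕ)}
    (hη : U.Handle L x d η) (hd' : U.IsLift x d d') (hr : U.Realizes x z L₀ η d') :
    U.Realizes x z L' η d' := by
  rcases hr with hr | ⟨hf, ho⟩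
  · exact .inl hr
  obtain ⟨hm, hne, hx, -⟩ := hη
  have hm2 := h.two_le_of_letter hm hne hx
  have hc2 := two_le hc hca (h.ne_right hcx)
  have hZ := pred_img_mem h hc hc2 hcx
  obtain ⟨h1, h2, h3, h4, h5⟩ := ho
  have hpm := pred_mem hm hm2
  have e1 := (h.isLift_ne hd hdx hc hcx hca hdc hd').2
  have e2 : pred d' ≠ pred (U.img x c) := by
    rcases hd' with rfl | ⟨hda, rfl⟩ | ⟨rfl, f, hf, hfe, hfl, rfl⟩
    · by_cases hda : d = (0, 1)
      · subst hda
        intro e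
        have h6 := hZ.1
        rw [← e, h.img_left] at h6
        simp [pred] at h6
      · exact (h.isLift_ne hd hdx hc hcx hca hdc (.inr (.inl ⟨hda, rfl⟩))).2
    · have hd2 := two_le hd hda (h.ne_right hdx)
      rw [pred_pred_img hd hd2 hdx]
      exact img_ne_pred_img (pred_mem hd hd2) hc hc2 hcx
    · have hfx : U.letter f ≠ some x := by
        rw [hfl, h.letter_right]
        exact fun e => h.ne (Option.some_injective _ e)
      have hf2 := h.two_le_of_letter hf hfe hfx
      rw [pred_img hf hf2 hfx]
      exact img_ne_pred_img (pred_mem hf hf2) hc hc2 hcx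
  have l1 : (pred d').2 ≤ (U.reduct x z (pred d').1).length := by
    have := h1.2
    simp only [pred]
    omega
  refine .inr ⟨hf, h1, h2, h3, ?_, ?_⟩
  · exact (ha.iff _ _ l1 h2.2 e2 (img_ne_pred_img hm hc hc2 hcx)).2 h4
  · rw [pred_img hm hm2 hx] at h5 ⊢
    exact (ha.iff _ _ (h.img_le_length hpm) h1.2 (img_ne_pred_img hpm hc hc2 hcx) e1).2 h5

/-- Closed walks at two occurrences of `x` give a cyclic lift. -/
theorem exists_cyclic_of_walks (h : U.Reducible L x z) {L₀ : 𝒳 → ℕ} (hl : U.Lifts L x z L₀)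
    {d c : Fin 2 × ℕ} (hd : d ∈ U.boundaries) (hdx : U.letter d = some x)
    (hc : c ∈ U.boundaries) (hcx : U.letter c = some x) (hca : c ≠ (0, 1)) (hdc : d ≠ c)
    (hwd : U.Walk L x d d) (hwc : U.Walk L x c c) :
    ∃ L', U.Lifts L x z L' ∧ (U.reduct x z).Cyclic L' := by
  by_contra! hac
  have hc2 := two_le hc hca (h.ne_right hcx)
  have hpc := pred_mem hc hc2
  have hX := h.img_mem hc (h.ne_right hcx)
  have hZ := h.pred_img_mem hc hc2 hcx
  obtain ⟨η, η', hη, hη', hdlift⟩ := (h.walk_lift hwd).resolve_left fun e => e.2.2.1 rfl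
  -- Here the realizers at `d` are fixed first: their letters decide where to move the boundary
  -- inside `c`, and by `realizes_of_agreesOff` the move does not disturb them.
  obtain ⟨u, hu, hur⟩ := h.exists_realizer hl hd hdx hη
  obtain ⟨u', hu', hur'⟩ := h.exists_realizer hl hd hdx hη'
  -- the handles at `c`, the left one first
  obtain ⟨g, g', hg, hg', hgg, hclift⟩ : ∃ g g', U.Handle L x c g ∧ U.Handle L x c g' ∧
      g.2.2 ≤ g'.2.2 ∧
      ∀ L', U.Lifts L x z L' → ∀ d' c', U.Realizes x z L' g d' → U.Realizes x z L' g' c' →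
        Alternating ((U.reduct x z).Overlap L') (U.reduct x z).Twin d' c' := by
    obtain ⟨g, g', hg, hg', hclift⟩ := (h.walk_lift hwc).resolve_left fun e => e.2.2.1 rfl
    rcases le_total g.2.2 g'.2.2 with hle | hle
    · exact ⟨g, g', hg, hg', hle, hclift⟩
    · exact ⟨g', g, hg', hg, hle, fun L' hl' d' c' h1 h2 =>
        (hclift L' hl' c' d' h2 h1).symm (fun h => h.symm) (fun h => h.symm)⟩
  obtain ⟨hgf, ho, hgm, hge, hgx⟩ := handle_of_ne hg hca
  obtain ⟨hgf', ho', hgm', hge', hgx'⟩ := handle_of_ne hg' hca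
  have hg2 := h.two_le_of_letter hgm hge hgx
  have hg2' := h.two_le_of_letter hgm' hge' hgx'
  have hside : g.2.1 = g'.2.1 := (side_eq_or ho.2.2.1 g'.2.1).resolve_left
    (fun e => ho'.2.2.1 e.symm) |>.symm
  -- closing up the two lifted walks
  have close : ∀ L', U.Lifts L x z L' → (U.reduct x z).AgreesOff (pred (U.img x c)) L₀ L' →
      ∀ v v', (U.reduct x z).Twin u' v → (U.reduct x z).Twin u v' →
      (U.Realizes x z L' g v ∧ U.Realizes x z L' g' v') ∨
        (U.Realizes x z L' g v' ∧ U.Realizes x z L' g' v) → False := by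
    intro L' hl' ha v v' hv hv' hr
    have hA := hdlift L' hl' u u' (h.realizes_of_agreesOff hd hdx hc hcx hca hdc ha hη hu hur)
      (h.realizes_of_agreesOff hd hdx hc hcx hca hdc ha hη' hu' hur')
    have hB : Alternating ((U.reduct x z).Overlap L') (U.reduct x z).Twin v v' := by
      rcases hr with ⟨h1, h2⟩ | ⟨h1, h2⟩
      · exact hclift L' hl' v v' h1 h2
      · exact (hclift L' hl' v' v h1 h2).symm (fun h => h.symm) (fun h => h.symm)
    exact hac L' hl' ⟨_, hA.closed₂ hv hB hv'.symm⟩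
  have tx := fun {u} => h.isLift_twin_img (d' := u) hd hdx hc hcx hca hdc
  have tz := fun {u} => h.isLift_twin_pred_img (d' := u) hd hdx hc hcx hca hdc
  have target := fun {k : Fin 2 × ℕ} (hk : k ∈ U.boundaries) (hke : k ≠ (1, 1))
      (hkx : U.letter k ≠ some x) (hk2 : 2 ≤ k.2) (ho : U.Overlap L c k) =>
    h.exists_target hl hac hc hca hcx (h.img_mem hk hke) ho.2.2.1.symm
      ((hl.iff _ hpc _ hk).2 ho.2.2.2.1)
      (by rw [pred_img hk hk2 hkx]; exact (hl.iff _ (pred_mem hk hk2) _ hc).2 ho.2.2.2.2)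
  have hle : ∀ L', U.Lifts L x z L' → (U.reduct x z).pos L' (U.img x g.2) ≤
      (U.reduct x z).pos L' (U.img x g'.2) := by
    intro L' hl'
    rw [← not_lt, hl'.iff _ hgm' _ hgm, not_lt]
    exact pos_le_pos_of_side_eq h.pos_letter hside hgg hgm'.2
  have hle' : ∀ L', U.Lifts L x z L' → (U.reduct x z).pos L' (pred (U.img x g.2)) ≤
      (U.reduct x z).pos L' (pred (U.img x g'.2)) := by
    intro L' hl'
    rw [pred_img hgm hg2 hgx, pred_img hgm' hg2' hgx', ← not_lt,
      hl'.iff _ (pred_mem hgm' hg2') _ (pred_mem hgm hg2), not_lt]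
    exact pos_le_pos_of_side_eq h.pos_letter hside (Nat.sub_le_sub_right hgg 1)
      (pred_mem hgm' hg2').2
  by_cases hzz : (U.reduct x z).letter u = some z ∧ (U.reduct x z).letter u' = some z
  -- Both ends at `c` must be the `z`-part. With the boundary in the right handle, the `z`-part
  -- reaches both handles.
  · obtain ⟨L', hl', ha, g1, g2, -, h4⟩ := target hgm' hge' hgx' hg2' ho'
    have h5 : (U.reduct x z).Overlap L' (pred (U.img x c)) (U.img x g.2) := by
      refine ⟨hZ, h.img_mem hgm hge, ho.2.2.1, ?_, (hle' L' hl').trans_lt g1⟩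
      rw [pred_pred_img hc hc2 hcx]
      exact (hl'.iff _ hpc _ hgm).2 ho.2.2.2.1
    exact close L' hl' ha _ _ (tz hu' hzz.2) (tz hu hzz.1)
      (.inl ⟨.inr ⟨hgf, h5⟩, .inr ⟨hgf', h4.symm⟩⟩)
  -- With the boundary in the left handle, the `x`-part meets both handles and the `z`-part meets
  -- the left one. This serves all other letter pairs, reversing the walk at `c` if necessary.
  · obtain ⟨L', hl', ha, g1, g2, h3, h4⟩ := target hgm hge hgx hg2 ho
    have h5 : (U.reduct x z).Overlap L' (U.img x c) (U.img x g'.2) := by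
      refine ⟨hX, h.img_mem hgm' hge', ho'.2.2.1, g2.trans_le (hle L' hl'), ?_⟩
      rw [pred_img hgm' hg2' hgx']
      exact (hl'.iff _ (pred_mem hgm' hg2') _ hc).2 ho'.2.2.2.2
    have rX : U.Realizes x z L' g (U.img x c) := .inr ⟨hgf, h3.symm⟩
    have rX' : U.Realizes x z L' g' (U.img x c) := .inr ⟨hgf', h5⟩
    have rZ : U.Realizes x z L' g (pred (U.img x c)) := .inr ⟨hgf, h4.symm⟩
    rcases (h.isLift_mem hd hdx hu).2 with hux | huz
    · rcases (h.isLift_mem hd hdx hu').2 with hux' | huz'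
      · exact close L' hl' ha _ _ (tx hu' hux') (tx hu hux) (.inl ⟨rX, rX'⟩)
      · exact close L' hl' ha _ _ (tz hu' huz') (tx hu hux) (.inl ⟨rZ, rX'⟩)
    · rcases (h.isLift_mem hd hdx hu').2 with hux' | huz'
      · exact close L' hl' ha _ _ (tx hu' hux') (tz hu huz) (.inr ⟨rZ, rX'⟩)
      · exact hzz ⟨huz, huz'⟩

/-- If the graph of `U` is cyclic and some lift exists, then some lift has a cyclic graph. -/
theorem exists_cyclic (h : U.Reducible L x z) {L₀ : 𝒳 → ℕ} (hl : U.Lifts L x z L₀)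
    (hcyc : U.Cyclic L) : ∃ L', U.Lifts L x z L' ∧ (U.reduct x z).Cyclic L' := by
  obtain ⟨p, hp⟩ := hcyc
  rcases exists_pattern (fun w _ => U.letter w = some x) (fun c d hM _ => hM.2.2.1) hp with
    ⟨q, hq⟩ | ⟨d, c, hdc, ⟨b, hb, hbx⟩, ⟨b', hb', hcx⟩, hw⟩ | ⟨d, c, hdc, ⟨hM, hdx⟩, hwd, hwc⟩
  · exact ⟨L₀, hl, h.cyclic_of_closed hl hq⟩
  · have hdx : U.letter d = some x := hb.2.2.2 ▸ hbx
    -- The leading `x` has lost its `z`-part, so the occurrence to be split must be a different one.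
    -- At least one of `c` and `d` is, and walks can be reversed.
    by_cases hca : c = (0, 1)
    · exact h.exists_cyclic_of_walk hl hb'.1 hcx hb.2.1 hdx (hca ▸ hdc) hdc.symm (walk_symm hw)
    · exact h.exists_cyclic_of_walk hl hb.2.1 hdx hb'.1 hcx hca hdc hw
  · have hcx : U.letter c = some x := hM.2.2.2 ▸ hdx
    by_cases hca : c = (0, 1)
    · exact h.exists_cyclic_of_walks hl hM.2.1 hcx hM.1 hdx (hca ▸ hdc) hdc.symm hwc hwd
    · exact h.exists_cyclic_of_walks hl hM.1 hdx hM.2.1 hcx hca hdc hwd hwc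

end Reducible

end WordEq

/-! ### Translation between boundary orders and length functions -/

namespace ExtWordEq

variable {𝒳 : Type*}

/-- The boundary order of `E` is the order of positions for the positive lengths `L`. -/
def RealizedBy (E : ExtWordEq 𝒳) (L : 𝒳 → ℕ) : Prop :=
  (∀ y, 0 < L y) ∧ ∀ a b : E.U.boundaries, E.lt a b ↔ E.U.pos L a.1 < E.U.pos L b.1

theorem coherent_iff {E : ExtWordEq 𝒳} : E.Coherent ↔ ∃ L, E.RealizedBy L := Iff.rfl

namespace RealizedBy

variable {E : ExtWordEq 𝒳} {L : 𝒳 → ℕ}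

theorem lt_iff (h : E.RealizedBy L) {p q : Fin 2 × ℕ} (hp : p.2 ≤ (E.U p.1).length)
    (hq : q.2 ≤ (E.U q.1).length) : E.Lt p q ↔ E.U.pos L p < E.U.pos L q := by
  constructor
  · rintro (⟨hp, hq, hlt⟩ | ⟨hp0, hq⟩)
    · exact (h.2 _ _).1 hlt
    · obtain ⟨i, j⟩ := p
      obtain rfl : j = 0 := hp0
      rw [WordEq.pos_zero]
      exact WordEq.pos_pos_of_mem h.1 hq
  · intro hlt
    have hq1 : 1 ≤ q.2 := by
      obtain ⟨i, j⟩ := q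
      rcases Nat.eq_zero_or_pos j with rfl | hj
      · simp at hlt
      · exact hj
    rcases Nat.eq_zero_or_pos p.2 with hp0 | hp0
    · exact .inr ⟨hp0, hq1, hq⟩
    · exact .inl ⟨⟨hp0, hp⟩, ⟨hq1, hq⟩, (h.2 _ _).2 hlt⟩

theorem equi_iff (h : E.RealizedBy L) {p q : Fin 2 × ℕ} (hp : p.2 ≤ (E.U p.1).length)
    (hq : q.2 ≤ (E.U q.1).length) : E.Equi p q ↔ E.U.pos L p = E.U.pos L q := by
  rw [Equi, h.lt_iff hp hq, h.lt_iff hq hp]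
  omega

theorem balanced (h : E.RealizedBy L) (hE : E.IsNontrivial) : E.U.Balanced L where
  pos_letter := h.1
  total i i' := by
    have hm : ∀ s, (s, (E.U s).length) ∈ E.U.boundaries :=
      fun s => ⟨List.length_pos_iff.2 (hE s), le_rfl⟩
    have := E.isBoundaryOrder.last_equiv ⟨_, hm i⟩ ⟨_, hm i'⟩ rfl rfl
    rw [h.2, h.2] at this
    simp only at this
    omega

theorem staggeredBy (h : E.RealizedBy L) (hE : E.Staggered) : E.U.StaggeredBy L := by
  intro i i' hi j hj j' hj' heq
  by_cases hi0 : i = 0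
  · subst hi0
    obtain rfl : i' = 1 :=
      (WordEq.side_eq_or (by decide : (0 : Fin 2) ≠ 1) i').resolve_left hi.symm
    exact hE j hj j' hj' ((h.equi_iff (p := (0, j)) (q := (1, j')) hj hj').2 heq)
  · obtain rfl : i = 1 := (WordEq.side_eq_or (by decide : (0 : Fin 2) ≠ 1) i).resolve_left hi0
    obtain rfl : i' = 0 := (WordEq.side_eq_or (by decide : (0 : Fin 2) ≠ 1) i').resolve_right hi.symm
    rcases hE j' hj' j hj ((h.equi_iff (p := (0, j')) (q := (1, j)) hj' hj).2 heq.symm) with h | h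
    · exact .inl h.symm
    · exact .inr h.symm

theorem staggered (h : E.RealizedBy L) (hs : E.U.StaggeredBy L) : E.Staggered := by
  intro j hj j' hj' heq
  exact hs 0 1 (by decide) j hj j' hj'
    ((h.equi_iff (p := (0, j)) (q := (1, j')) hj hj').1 heq)

theorem pred_le {p : Fin 2 × ℕ} (hp : p ∈ E.U.boundaries) :
    (WordEq.pred p).2 ≤ (E.U (WordEq.pred p).1).length :=
  (Nat.sub_le _ _).trans hp.2

theorem overlap_of_cuts (h : E.RealizedBy L) {a b : E.U.boundaries} (hab : E.Cuts a b) :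
    E.U.Overlap L a.1 b.1 := by
  obtain ⟨hne, h1, h2⟩ := hab
  have h1' := (h.lt_iff (p := WordEq.pred a.1) (pred_le a.2) b.2.2).1 h1
  have h2' := (h.lt_iff (p := WordEq.pred b.1) (pred_le b.2) a.2.2).1 h2
  refine ⟨a.2, b.2, fun hside => hne ?_, h1', h2'⟩
  obtain ⟨⟨i, j⟩, ha⟩ := a
  obtain ⟨⟨i', k⟩, hb⟩ := b
  obtain rfl : i = i' := hside
  have hj := ha.1
  have hk := hb.1
  have g1 := (WordEq.pos_lt_pos_iff h.1 (pred_le ha) hb.2).1 h1'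
  have g2 := (WordEq.pos_lt_pos_iff h.1 (pred_le hb) ha.2).1 h2'
  simp only [WordEq.pred] at g1 g2 hj hk
  obtain rfl : j = k := by omega
  rfl

theorem cuts_of_overlap (h : E.RealizedBy L) {a b : E.U.boundaries}
    (hab : E.U.Overlap L a.1 b.1) : E.Cuts a b := by
  obtain ⟨-, -, hs, h1, h2⟩ := hab
  exact ⟨fun e => hs (by rw [e]), (h.lt_iff (p := WordEq.pred a.1) (pred_le a.2) b.2.2).2 h1,
    (h.lt_iff (p := WordEq.pred b.1) (pred_le b.2) a.2.2).2 h2⟩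

theorem letter_eq (E : ExtWordEq 𝒳) (a : E.U.boundaries) :
    E.U.letter a.1 = some (E.U.var a) :=
  List.getElem?_eq_getElem _

theorem cyclic (h : E.RealizedBy L) (hE : ¬ E.cutGraph.IsAcyclicDigraph) : E.U.Cyclic L := by
  simp only [Digraph.IsAcyclicDigraph, not_forall, not_not] at hE
  obtain ⟨v, hv⟩ := hE
  refine ⟨v.1, Relation.TransGen.lift (fun a : E.U.boundaries => a.1) ?_ _ _ hv⟩
  rintro a b ⟨c, hac, hcb⟩
  refine ⟨c.1, h.overlap_of_cuts hac, c.2, b.2, fun (e : c.1 = b.1) => ?_, ?_⟩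
  · obtain ⟨-, h1 | h1⟩ := hcb
    · rw [h.equi_iff c.2.2 b.2.2, e] at h1
      exact h1 rfl
    · rw [e] at h1
      exact h1 ((h.equi_iff (p := WordEq.pred b.1) (pred_le b.2) (pred_le b.2)).2 rfl)
  · rw [letter_eq, letter_eq, hcb.1]

/-- Twins fail to mirror each other only if both their left ends and their right ends are
equivalent. By staggeredness, distinct twins of this kind fill the two sides completely, which
`hlen` excludes. -/
theorem not_acyclic (h : E.RealizedBy L) (hs : E.U.StaggeredBy L)
    (hlen : ∃ i, (E.U i).length ≠ 1) (hc : E.U.Cyclic L) : ¬ E.cutGraph.IsAcyclicDigraph := by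
  have hmirror : ∀ a b : E.U.boundaries, E.U.Twin a.1 b.1 → E.Mirrors a b := by
    intro a b hab
    obtain ⟨-, -, hne, hl⟩ := hab
    rw [letter_eq, letter_eq] at hl
    refine ⟨Option.some_injective _ hl, ?_⟩
    by_contra! hcon
    obtain ⟨h1, h2⟩ := hcon
    rw [h.equi_iff a.2.2 b.2.2] at h1
    replace h2 := (h.equi_iff (p := WordEq.pred a.1) (q := WordEq.pred b.1) (pred_le a.2)
      (pred_le b.2)).1 h2
    obtain ⟨⟨i, j⟩, ha⟩ := a
    obtain ⟨⟨i', k⟩, hb⟩ := b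
    have hj := ha.1
    have hk := hb.1
    simp only at hj hk
    by_cases hi : i = i'
    · subst hi
      refine hne ?_
      have g1 := WordEq.pos_lt_pos_iff h.1 ha.2 hb.2
      have g2 := WordEq.pos_lt_pos_iff h.1 hb.2 ha.2
      simp only at h1 g1 g2
      rw [h1] at g1 g2
      obtain rfl : j = k := by
        have := mt g1.2 (lt_irrefl _)
        have := mt g2.2 (lt_irrefl _)
        omega
      rfl
    · have g1 := hs i i' hi j ha.2 k hb.2 h1
      have g2 := hs i i' hi (j - 1) (pred_le ha) (k - 1) (pred_le hb) h2
      obtain ⟨s, hs⟩ := hlen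
      have := ha.2
      have := hb.2
      simp only at *
      rcases WordEq.side_eq_or hi s with rfl | rfl <;> omega
  obtain ⟨p, hp⟩ := hc
  intro hac
  have key : ∀ q, Relation.TransGen (E.U.Step L) p q → ∀ (hp : p ∈ E.U.boundaries)
      (hq : q ∈ E.U.boundaries), Relation.TransGen E.cutGraph.Adj ⟨p, hp⟩ ⟨q, hq⟩ := by
    intro q hpq hp
    induction hpq with
    | single h1 =>
      intro hq
      obtain ⟨c, hc1, hc2⟩ := h1
      exact .single ⟨⟨c, hc2.1⟩, h.cuts_of_overlap hc1, hmirror ⟨c, hc2.1⟩ ⟨_, hq⟩ hc2⟩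
    | tail _ h2 ih =>
      intro hq
      obtain ⟨c, hc1, hc2⟩ := h2
      exact (ih hc1.1).tail
        ⟨⟨c, hc2.1⟩, h.cuts_of_overlap (a := ⟨_, hc1.1⟩) hc1, hmirror ⟨c, hc2.1⟩ ⟨_, hq⟩ hc2⟩
  obtain ⟨q, ⟨c, hc1, -⟩, -⟩ := Relation.TransGen.head'_iff.1 hp
  exact hac ⟨p, hc1.1⟩ (key p hp hc1.1 hc1.1)

theorem isNontrivial (h : E.RealizedBy L) (hE : ¬ E.cutGraph.IsAcyclicDigraph) :
    E.IsNontrivial := by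
  obtain ⟨p, hp⟩ := h.cyclic hE
  obtain ⟨q, ⟨c, ⟨h1, h2, h3, -⟩, -⟩, -⟩ := Relation.TransGen.head'_iff.1 hp
  intro i
  rw [← List.length_pos_iff]
  rcases WordEq.side_eq_or h3 i with rfl | rfl
  · exact h1.1.trans h1.2
  · exact h2.1.trans h2.2

end RealizedBy

/-- The extended word equation with the boundary order given by a length function. -/
def ofLengths (U : WordEq 𝒳) (L : 𝒳 → ℕ) (hL : U.Balanced L) : ExtWordEq 𝒳 where
  U := U
  lt a b := U.pos L a.1 < U.pos L b.1
  isBoundaryOrder :=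
    { strictWeak :=
        { irrefl := fun _ => lt_irrefl _
          trans := fun _ _ _ => lt_trans
          incomp_trans := fun _ _ _ h₁ h₂ => by omega }
      extends_side := by
        rintro ⟨⟨i, j⟩, ha⟩ ⟨⟨i', k⟩, hb⟩ hi hjk
        obtain rfl : i = i' := hi
        exact WordEq.pos_lt_pos hL.pos_letter hjk hb.2
      last_equiv := by
        rintro ⟨⟨i, j⟩, ha⟩ ⟨⟨i', k⟩, hb⟩ hj hk
        obtain rfl : j = (U i).length := hj
        obtain rfl : k = (U i').length := hk
        have := hL.total i i'
        simp only
        omega }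

theorem realizedBy_ofLengths {U : WordEq 𝒳} {L : 𝒳 → ℕ} (hL : U.Balanced L) :
    (ofLengths U L hL).RealizedBy L :=
  ⟨hL.pos_letter, fun _ _ => Iff.rfl⟩

/-! ### Duality -/

section Dual

variable {E : ExtWordEq 𝒳}

theorem swapSide_swapSide (p : Fin 2 × ℕ) : swapSide (swapSide p) = p := by
  simp [swapSide]

/-- The boundary of the dual that corresponds to a boundary. -/
def swapBoundary (E : ExtWordEq 𝒳) (a : E.U.boundaries) : E.dual.U.boundaries :=
  ⟨swapSide a.1, by
    obtain ⟨⟨i, j⟩, h1, h2⟩ := a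
    refine ⟨h1, ?_⟩
    simpa [dual, swapSide] using h2⟩

theorem dual_lt_iff (p q : Fin 2 × ℕ) : E.dual.Lt (swapSide p) (swapSide q) ↔ E.Lt p q := by
  obtain ⟨i, j⟩ := p
  obtain ⟨i', k⟩ := q
  fin_cases i <;> fin_cases i' <;> exact Iff.rfl

theorem dual_equi_iff (p q : Fin 2 × ℕ) :
    E.dual.Equi (swapSide p) (swapSide q) ↔ E.Equi p q := by
  rw [Equi, Equi, dual_lt_iff, dual_lt_iff]

theorem var_swapBoundary (a : E.U.boundaries) : E.dual.U.var (E.swapBoundary a) = E.U.var a := by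
  obtain ⟨⟨i, j⟩, h1, h2⟩ := a
  fin_cases i <;> rfl

theorem acyclic_of_dual (h : E.dual.cutGraph.IsAcyclicDigraph) :
    E.cutGraph.IsAcyclicDigraph := by
  intro v hv
  refine h _ (Relation.TransGen.lift E.swapBoundary ?_ _ _ hv)
  rintro a b ⟨c, ⟨h1, h2, h3⟩, h4, h5⟩
  refine ⟨E.swapBoundary c, ⟨fun e => h1 ?_, ?_, ?_⟩, ?_, ?_⟩
  · have := congrArg (fun a => swapSide a.1) e
    simp only [swapBoundary, swapSide_swapSide] at this
    exact Subtype.ext this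
  · exact (dual_lt_iff (a.1.1, a.1.2 - 1) c.1).2 h2
  · exact (dual_lt_iff (c.1.1, c.1.2 - 1) a.1).2 h3
  · rw [var_swapBoundary, var_swapBoundary, h4]
  · rw [← dual_equi_iff c.1 b.1, ← dual_equi_iff (c.1.1, c.1.2 - 1) (b.1.1, b.1.2 - 1)] at h5
    exact h5

theorem staggered_dual_iff : E.dual.Staggered ↔ E.Staggered := by
  have key : ∀ j j', E.dual.Equi (0, j) (1, j') ↔ E.Equi (0, j') (1, j) := fun j j' => by
    rw [show E.dual.Equi (0, j) (1, j') ↔ E.Equi (1, j) (0, j') from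
      dual_equi_iff (1, j) (0, j'), Equi, Equi, and_comm]
  constructor
  · intro h j hj j' hj' he
    rcases h j' hj' j hj ((key _ _).2 he) with h | h
    · exact .inl h.symm
    · exact .inr h.symm
  · intro h j hj j' hj' he
    rcases h j' hj' j hj ((key _ _).1 he) with h | h
    · exact .inl h.symm
    · exact .inr h.symm

theorem coherent_dual_iff : E.dual.Coherent ↔ E.Coherent := by
  constructor
  · rintro ⟨L, hL, h⟩
    refine ⟨L, hL, ?_⟩
    rintro ⟨⟨i, j⟩, ha⟩ ⟨⟨i', k⟩, hb⟩
    have := h (E.swapBoundary ⟨⟨i, j⟩, ha⟩) (E.swapBoundary ⟨⟨i', k⟩, hb⟩)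
    fin_cases i <;> fin_cases i' <;> exact this
  · rintro ⟨L, hL, h⟩
    exact ⟨L, hL, fun a b => h ⟨swapSide a.1, a.2⟩ ⟨swapSide b.1, b.2⟩⟩

end Dual

/-! ### Extended Nielsen transformations -/

section Nielsen

variable [DecidableEq 𝒳]

/-- The lengths that realize a coherent result of case II lift those that realize `E`. -/
theorem lifts_of_nielsenII {E E₀ : ExtWordEq 𝒳} {L L₀ : 𝒳 → ℕ} {x z : 𝒳}
    (hL : E.RealizedBy L) (h : E.U.Reducible L x z)
    (hL₀ : E₀.RealizedBy L₀) (hs : E₀.Staggered) (hU : E₀.U = E.U.reduct x z)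
    (hold : ∀ a b : E₀.U.boundaries, a.1 ∈ E.U.oldBoundaries x → b.1 ∈ E.U.oldBoundaries x →
      (E₀.lt a b ↔ E.Lt (a.1.1, E₀.U.nu x a.1) (b.1.1, E₀.U.nu x b.1)))
    (h2 : ((1 : Fin 2), 2) ∈ E.U.boundaries) : E.U.Lifts L x z L₀ := by
  have hmem : ∀ p ∈ E.U.boundaries, p ≠ (1, 1) → E.U.img x p ∈ E₀.U.boundaries :=
    fun p hp hne => hU ▸ h.img_mem hp hne
  have hnt₀ : E₀.IsNontrivial := by
    intro i
    rw [← List.length_pos_iff]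
    rcases WordEq.side_eq_or (by decide : (0 : Fin 2) ≠ 1) i with rfl | rfl
    · have := hmem _ h.left_mem (by decide)
      exact this.1.trans this.2
    · have := hmem _ h2 (by decide)
      exact this.1.trans this.2
  refine ⟨hU ▸ hL₀.balanced hnt₀, hU ▸ hL₀.staggeredBy hs, ?_⟩
  -- The hypothesis `hold` says nothing about `(1, 1)`, but this boundary is the least one and its
  -- image is at position zero.
  have hmin : ∀ q ∈ E.U.boundaries, q ≠ (1, 1) → E.U.pos L (1, 1) < E.U.pos L q := by
    rintro ⟨i, j⟩ hq hne
    have hj := hq.1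
    simp only at hj
    rcases WordEq.side_eq_or (by decide : (0 : Fin 2) ≠ 1) i with rfl | rfl
    · exact h.pos_right_lt.trans_le (WordEq.pos_le_pos h.pos_letter hj hq.2)
    · refine WordEq.pos_lt_pos h.pos_letter (lt_of_le_of_ne hj fun e => hne ?_) hq.2
      exact Prod.ext rfl e.symm
  have hzero : (E.U.reduct x z).pos L₀ (E.U.img x (1, 1)) = 0 := by
    rw [h.img_right, WordEq.pos_zero]
  have himgpos : ∀ q ∈ E.U.boundaries, q ≠ (1, 1) →
      0 < (E.U.reduct x z).pos L₀ (E.U.img x q) :=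
    fun q hq hne => WordEq.pos_pos_of_mem hL₀.1 (h.img_mem hq hne)
  intro p hp q hq
  by_cases hp1 : p = (1, 1)
  · by_cases hq1 : q = (1, 1)
    · rw [hp1, hq1]
      simp
    · rw [hp1, hzero]
      exact iff_of_true (himgpos q hq hq1) (hmin q hq hq1)
  · by_cases hq1 : q = (1, 1)
    · rw [hq1, hzero]
      exact iff_of_false (by omega) (hmin p hp hp1).asymm
    · have := hold ⟨_, hmem p hp hp1⟩ ⟨_, hmem q hq hq1⟩ ⟨p, hp, hp1, rfl⟩ ⟨q, hq, hq1, rfl⟩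
      rw [hL₀.2] at this
      simp only [hU] at this
      rw [this, h.nu_img hp, h.nu_img hq]
      exact hL.lt_iff hp.2 hq.2

/-- Case II of the theorem. -/
theorem exists_cyclic_nielsenII {E E₀ : ExtWordEq 𝒳} (hc : E.Coherent)
    (hcyc : ¬ E.cutGraph.IsAcyclicDigraph) (hn : NielsenII E E₀) (hc₀ : E₀.Coherent)
    (hs₀ : E₀.Staggered) :
    ∃ E', NielsenII E E' ∧ E'.Coherent ∧ E'.Staggered ∧ ¬ E'.cutGraph.IsAcyclicDigraph := by
  obtain ⟨L, hL⟩ := coherent_iff.1 hc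
  obtain ⟨L₀, hL₀⟩ := coherent_iff.1 hc₀
  have hnt := hL.isNontrivial hcyc
  have hbal := hL.balanced hnt
  obtain ⟨x, z, hx, hz, hlt, hU, hold⟩ := hn
  have hlen : ∀ i, 1 ≤ (E.U i).length := fun i => List.length_pos_iff.2 (hnt i)
  have hlt' := (hL.lt_iff (p := (1, 1)) (q := (0, 1)) (hlen 1) (hlen 0)).1 hlt
  have hxl : E.U.letter (0, 1) = some x := by rw [← hx, List.head?_eq_getElem?]; rfl
  have hzl : E.U.letter (1, 1) = some z := by rw [← hz, List.head?_eq_getElem?]; rfl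
  have h : E.U.Reducible L x z := by
    refine ⟨hxl, hzl, hL.1, ?_⟩
    rw [WordEq.pos_succ (j := 0) L hxl, WordEq.pos_succ (j := 0) L hzl] at hlt'
    simpa using hlt'
  -- A second side consisting of `z` alone would be shorter than the first side, which begins with
  -- `x`.
  have h2 : ((1 : Fin 2), 2) ∈ E.U.boundaries := by
    refine ⟨by simp, ?_⟩
    by_contra hcon
    have h1 : (E.U 1).length = 1 := by have := hlen 1; simp only at hcon; omega
    have h3 := hbal.total 0 1
    have h4 := WordEq.pos_le_pos (U := E.U) (i := 0) hL.1 (hlen 0) le_rfl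
    rw [h1] at h3
    omega
  have hl := lifts_of_nielsenII hL h hL₀ hs₀ (funext hU) hold h2
  obtain ⟨L', hl', hcyc'⟩ := h.exists_cyclic hl (hL.cyclic hcyc)
  have hr := realizedBy_ofLengths hl'.balanced
  refine ⟨ofLengths _ L' hl'.balanced, ⟨x, z, hx, hz, hlt, fun _ => rfl, ?_⟩, ⟨L', hr⟩,
    hr.staggered hl'.staggered, hr.not_acyclic hl'.staggered ?_ hcyc'⟩
  · rintro ⟨a, ha⟩ ⟨b, hb⟩ ⟨p, hp, hp1, rfl⟩ ⟨q, hq, hq1, rfl⟩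
    rw [hr.2]
    show (E.U.reduct x z).pos L' (E.U.img x p) < (E.U.reduct x z).pos L' (E.U.img x q) ↔
      E.Lt (p.1, (E.U.reduct x z).nu x (E.U.img x p)) (q.1, (E.U.reduct x z).nu x (E.U.img x q))
    rw [h.nu_img hp, h.nu_img hq, hl'.iff p hp q hq]
    exact (hL.lt_iff hp.2 hq.2).symm
  · -- otherwise the reduct would consist of two different letters
    by_contra! hone
    replace hone : ∀ i, (E.U.reduct x z i).length = 1 := hone
    obtain ⟨p, hp⟩ := hcyc'
    obtain ⟨q, ⟨c, -, hcq⟩, -⟩ := Relation.TransGen.head'_iff.1 hp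
    have himg := h.img_mem h2 (by decide)
    have hmu : E.U.img x (1, 2) = (1, 1) := by
      have h3 := himg.1
      have h4 := himg.2
      rw [hone] at h4
      exact Prod.ext rfl (le_antisymm h4 h3)
    have hx2 : E.U.letter (1, 2) ≠ some x := fun e => by
      have := WordEq.Reducible.two_le_img (p := (1, 2)) (le_refl 2) e
      rw [hmu] at this
      simp at this
    have hl1 : (E.U.reduct x z).letter (1, 1) ≠ some x := by
      rw [← hmu, h.letter_img h2 (by decide)]
      exact hx2
    have hl0 : (E.U.reduct x z).letter (0, 1) = some x := by
      have := h.letter_img h.left_mem (by decide)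
      rwa [h.img_left, h.letter_left] at this
    have hform : ∀ p ∈ (E.U.reduct x z).boundaries, p = (0, 1) ∨ p = (1, 1) := by
      rintro ⟨i, j⟩ ⟨h3, h4⟩
      rw [hone] at h4
      obtain rfl : j = 1 := le_antisymm h4 h3
      rcases WordEq.side_eq_or (by decide : (0 : Fin 2) ≠ 1) i with rfl | rfl <;> simp
    obtain ⟨hcm, hqm, hne, hleq⟩ := hcq
    rcases hform c hcm with rfl | rfl <;> rcases hform q hqm with rfl | rfl
    · exact hne rfl
    · exact hl1 (hleq ▸ hl0)
    · exact hl1 (hleq ▸ hl0)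
    · exact hne rfl

/-- Equivalent first boundaries of a staggered equation are also the last ones. With one letter on
each side all left ends and all right ends are equivalent, so nothing mirrors anything. -/
theorem acyclic_of_nielsenI {E E₀ : ExtWordEq 𝒳} (hc : E.Coherent) (hs : E.Staggered)
    (hnt : E.IsNontrivial) (hn : NielsenI E E₀) : E.cutGraph.IsAcyclicDigraph := by
  obtain ⟨L, hL⟩ := coherent_iff.1 hc
  obtain ⟨x, z, -, -, he, -⟩ := hn
  have hlen : ∀ i, 1 ≤ (E.U i).length := fun i => List.length_pos_iff.2 (hnt i)
  have hbal := hL.balanced hnt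
  obtain ⟨h0, h1⟩ := (hs 1 (hlen 0) 1 (hlen 1) he).resolve_left (by simp)
  have hone : ∀ i, (E.U i).length = 1 := by
    intro i
    rcases WordEq.side_eq_or (by decide : (0 : Fin 2) ≠ 1) i with rfl | rfl
    · exact h0.symm
    · exact h1.symm
  have hno : ∀ a b : E.U.boundaries, ¬ E.Mirrors a b := by
    rintro ⟨⟨i, j⟩, ha1, ha2⟩ ⟨⟨i', k⟩, hb1, hb2⟩ ⟨-, h⟩
    have ht := hbal.total i i'
    rw [hone] at ha2 hb2
    obtain rfl : j = 1 := le_antisymm ha2 ha1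
    obtain rfl : k = 1 := le_antisymm hb2 hb1
    rw [hone, hone] at ht
    rcases h with h | h
    · exact h ((hL.equi_iff (p := (i, 1)) (q := (i', 1)) (hlen i) (hlen i')).2 ht)
    · refine h ((hL.equi_iff (p := (i, 0)) (q := (i', 0)) (Nat.zero_le _) (Nat.zero_le _)).2 ?_)
      simp
  intro v hv
  obtain ⟨_, ⟨c, -, hcb⟩, -⟩ := Relation.TransGen.head'_iff.1 hv
  exact hno _ _ hcb

/-- A staggered coherent equation with a cyclic cut graph and some staggered coherent
transformation has one with a cyclic cut graph. -/
theorem exists_cyclic_nielsen {E E₀ : ExtWordEq 𝒳} (hs : E.Staggered) (hc : E.Coherent)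
    (hcyc : ¬ E.cutGraph.IsAcyclicDigraph) (hn : CoherentNielsen E E₀) (hs₀ : E₀.Staggered) :
    ∃ E', E.CoherentNielsen E' ∧ E'.Staggered ∧ ¬ E'.cutGraph.IsAcyclicDigraph := by
  obtain ⟨⟨hnt, -, hI | hII | ⟨hlt, F, hF, rfl⟩⟩, hc₀⟩ := hn
  · exact absurd (acyclic_of_nielsenI hc hs hnt hI) hcyc
  · obtain ⟨E', h1, h2, h3, h4⟩ := exists_cyclic_nielsenII hc hcyc hII hc₀ hs₀
    exact ⟨E', ⟨⟨hnt, hc, .inr (.inl h1)⟩, h2⟩, h3, h4⟩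
  · obtain ⟨F', h1, h2, h3, h4⟩ := exists_cyclic_nielsenII (coherent_dual_iff.2 hc)
      (mt acyclic_of_dual hcyc) hF (coherent_dual_iff.1 hc₀) (staggered_dual_iff.1 hs₀)
    exact ⟨F'.dual, ⟨⟨hnt, hc, .inr (.inr ⟨hlt, F', h1, rfl⟩)⟩, coherent_dual_iff.2 h2⟩,
      staggered_dual_iff.2 h3, mt acyclic_of_dual h4⟩

end Nielsen

end ExtWordEq

/-! ### The theorem -/

theorem theorem2 {𝒳 : Type*} [DecidableEq 𝒳] (E : ExtWordEq 𝒳) (hE : E.HereditarilyStaggered) :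
    (E.Terminating → E.cutGraph.IsAcyclicDigraph) ∧
    (¬ E.cutGraph.IsAcyclicDigraph →
      ∃ E' : ExtWordEq 𝒳, E.CoherentNielsen E' ∧ E'.Staggered ∧
        ¬ E'.cutGraph.IsAcyclicDigraph) := by
  obtain ⟨S, hS, hES⟩ := hE
  have step : ∀ E ∈ S, ¬ E.cutGraph.IsAcyclicDigraph → ∃ E' : ExtWordEq 𝒳,
      E.CoherentNielsen E' ∧ E'.Staggered ∧ ¬ E'.cutGraph.IsAcyclicDigraph := by
    intro E hE hcyc
    have hc := hS.coherent E hE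
    obtain ⟨L, hL⟩ := ExtWordEq.coherent_iff.1 hc
    obtain ⟨E₀, hn, hs₀⟩ := hS.exists_step E hE (hL.isNontrivial hcyc)
    exact ExtWordEq.exists_cyclic_nielsen (hS.staggered E hE) hc hcyc hn hs₀
  refine ⟨fun hterm => ?_, step E hES⟩
  by_contra hcyc
  -- Cyclic members of `S` always have a cyclic successor in `S`; iterating a choice of successors
  -- contradicts termination.
  let T := {E : ExtWordEq 𝒳 // E ∈ S ∧ ¬ E.cutGraph.IsAcyclicDigraph}
  have next : ∀ F : T, ∃ F' : T, F.1.CoherentNielsen F'.1 := by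
    rintro ⟨F, hF, hFc⟩
    obtain ⟨F', h1, h2, h3⟩ := step F hF hFc
    exact ⟨⟨F', hS.closed F hF F' h1 h2, h3⟩, h1⟩
  choose f hf using next
  exact hterm ⟨fun n => (f^[n] ⟨E, hES, hcyc⟩).1, .refl, fun n => by
    simp only [Function.iterate_succ_apply']
    exact hf _⟩
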